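/- Theorem (VC-dimension of m-halfspaces). Let $G=(V,E)$ be a finite, simple, undirected, connected graph. A set $S\subseteq V$ is monophonically convex if, for all $u,v\in S$, every vertex lying on an induced path of $G$ between $u$ and $v$ belongs to $S$. An m-halfspace of $G$ is a set $H\subseteq V$ such that both $H$ and $V\setminus H$ are monophonically convex. Let $\mathcal H_m(G)$ be the set of all m-halfspaces of $G$ and, for an edge $ab\in E$, let $\mathcal H_m(ab)=\{H\in\mathcal H_m(G): a\in H,\ b\notin H\}$. For a family $\mathcal F$ of subsets of $V$, the VC-dimension $\mathrm{VC}(\mathcal F)$ is the size of a largest set $S\subseteq V$ with $\{F\cap S: F\in\mathcal F\}=2^S$ (and $0$ if $\mathcal F=\varnothing$). Let $d_{ab}=\mathrm{VC}(\mathcal H_m(ab))$ and $\hat d=\max_{ab\in E} d_{ab}$ (with $\hat d=0$ if $E=\varnothing$). Then $$\hat d\;\le\;\mathrm{VC}(\mathcal H_m(G))\;\le\;\hat d+4 .$$ Moreover, $\hat d$ can be computed in polynomial time: there is an algorithm which, given the adjacency matrix of a connected graph $G$ on $n$ vertices, outputs $\hat d$ after a number of steps that is bounded by a fixed polynomial in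 $n$. -/

import Mathlib

/-! ### Monophonic halfspaces -/

namespace Monophonic

/-- The monophonic interval `I_m(u, v)`: all vertices lying on some induced path from `u` to `v`. -/
def interval {V : Type*} (G : SimpleGraph V) (u v : V) : Set V :=
  {z | ∃ w : G.Walk u v, w.IsPath ∧ w.IsChordless ∧ z ∈ w.support}

/-- `S` is monophonically convex: it contains `I_m(u, v)` for all `u, v ∈ S`. -/
def IsConvex {V : Type*} (G : SimpleGraph V) (S : Set V) : Prop :=
  ∀ u ∈ S, ∀ v ∈ S, interval G u v ⊆ S

/-- `H` is a monophonic halfspace: `H` and its complement are monophonically convex. -/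
def IsHalfspace {V : Type*} (G : SimpleGraph V) (H : Set V) : Prop :=
  IsConvex G H ∧ IsConvex G Hᶜ

open Classical in
/-- The family of all monophonic halfspaces of a finite graph. -/
noncomputable def halfspaces {V : Type*} [Fintype V] (G : SimpleGraph V) : Finset (Finset V) :=
  Finset.univ.filter fun H => IsHalfspace G (H : Set V)

/-- The family of all monophonic halfspaces that contain `a` and avoid `b`. -/
noncomputable def edgeHalfspaces {V : Type*} [Fintype V] [DecidableEq V] (G : SimpleGraph V) (a b : V) :
    Finset (Finset V) :=
  (halfspaces G).filter fun H => a ∈ H ∧ b ∉ H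

open Classical in
/-- The maximum over all edges `ab` of the VC-dimension of the family of monophonic halfspaces that
contain `a` and avoid `b`. (The pairs `(a, b)` and `(b, a)` give families that consist of the
complements of each other, so they have the same VC-dimension. The value is `0` if there is no
edge; an empty family has VC-dimension `0`.) -/
noncomputable def maxEdgeVCDim {V : Type*} [Fintype V] [DecidableEq V] (G : SimpleGraph V) : ℕ :=
  (Finset.univ.filter fun e : V × V => G.Adj e.1 e.2).sup
    fun e => (edgeHalfspaces G e.1 e.2).vcDim

end Monophonic

/-! ### A random access machine

A small imperative language with explicit step counting. A program uses fixed numbered scalar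
variables and fixed numbered two-dimensional arrays, all holding natural numbers. The only
arithmetic is addition, truncated subtraction and comparison (no multiplication), so in `t` steps a
program touches at most `t` cells and creates numbers with `O(t)` more bits than the constants and
inputs: running times agree with those of Turing machines up to a polynomial. -/

namespace RAM

/-- A memory state: the scalar variables and the arrays. -/
structure State where
  var : ℕ → ℕ
  arr : ℕ → ℕ → ℕ → ℕ

/-- Expressions: constants, the variable `x`, the cell `A[i, j]` of the array `A`, sums,
truncated differences, and the test `e < e'` (with value `1` for true and `0` for false). -/
inductive Expr where
  | const (c : ℕ)
  | var (x : ℕ)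
  | get (A : ℕ) (i j : Expr)
  | add (e e' : Expr)
  | sub (e e' : Expr)
  | lt (e e' : Expr)

/-- The value of an expression in a state. -/
def Expr.eval (s : State) : Expr → ℕ
  | const c => c
  | var x => s.var x
  | get A i j => s.arr A (i.eval s) (j.eval s)
  | add e e' => e.eval s + e'.eval s
  | sub e e' => e.eval s - e'.eval s
  | lt e e' => if e.eval s < e'.eval s then 1 else 0

/-- The number of steps that it takes to evaluate an expression: one for each node. -/
def Expr.cost : Expr → ℕ
  | const _ => 1
  | var _ => 1
  | get _ i j => i.cost + j.cost + 1
  | add e e' => e.cost + e'.cost + 1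
  | sub e e' => e.cost + e'.cost + 1
  | lt e e' => e.cost + e'.cost + 1

/-- Programs: do nothing, `x := e`, `A[i, j] := e`, sequencing, branching on `e ≠ 0`, and
`while e ≠ 0 do c`. -/
inductive Program where
  | skip
  | assign (x : ℕ) (e : Expr)
  | store (A : ℕ) (i j e : Expr)
  | seq (c c' : Program)
  | ite (e : Expr) (c c' : Program)
  | while (e : Expr) (c : Program)

/-- `Runs c s s' t`: the program `c`, started in the state `s`, halts in the state `s'` after
exactly `t` steps. -/
inductive Runs : Program → State → State → ℕ → Prop where
  | skip (s : State) : Runs .skip s s 1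
  | assign (x : ℕ) (e : Expr) (s : State) :
      Runs (.assign x e) s { s with var := Function.update s.var x (e.eval s) } (e.cost + 1)
  | store (A : ℕ) (i j e : Expr) (s : State) :
      Runs (.store A i j e) s
        { s with
          arr := Function.update s.arr A (Function.update (s.arr A) (i.eval s)
            (Function.update (s.arr A (i.eval s)) (j.eval s) (e.eval s))) }
        (i.cost + j.cost + e.cost + 1)
  | seq {c c' : Program} {s s' s'' : State} {t t' : ℕ} :
      Runs c s s' t → Runs c' s' s'' t' → Runs (.seq c c') s s'' (t + t' + 1)
  | ite_true {e : Expr} {c c' : Program} {s s' : State} {t : ℕ} :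
      e.eval s ≠ 0 → Runs c s s' t → Runs (.ite e c c') s s' (e.cost + t + 1)
  | ite_false {e : Expr} {c c' : Program} {s s' : State} {t : ℕ} :
      e.eval s = 0 → Runs c' s s' t → Runs (.ite e c c') s s' (e.cost + t + 1)
  | while_true {e : Expr} {c : Program} {s s' s'' : State} {t t' : ℕ} :
      e.eval s ≠ 0 → Runs c s s' t → Runs (.while e c) s' s'' t' →
        Runs (.while e c) s s'' (e.cost + t + t' + 1)
  | while_false {e : Expr} {c : Program} {s : State} :
      e.eval s = 0 → Runs (.while e c) s s (e.cost + 1)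

open Classical in
/-- The input state for a graph with vertices `0, …, n - 1`: variable `0` holds `n`, array `0`
holds the adjacency matrix, and everything else is `0`. -/
noncomputable def graphInput {n : ℕ} (G : SimpleGraph (Fin n)) : State where
  var x := if x = 0 then n else 0
  arr A i j := if A = 0 ∧ ∃ (hi : i < n) (hj : j < n), G.Adj ⟨i, hi⟩ ⟨j, hj⟩ then 1 else 0

/-- The number-valued graph parameter `f` can be computed in polynomial time on all graphs with the
property `P`: there are one program and one polynomial `p` such that for every graph on `n`
vertices with property `P` the program halts within `p n` steps with the value of `f` in
variable `0`. -/
def PolyTimeComputable (P : ∀ n : ℕ, SimpleGraph (Fin n) → Prop)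
    (f : ∀ n : ℕ, SimpleGraph (Fin n) → ℕ) : Prop :=
  ∃ (c : Program) (p : Polynomial ℕ), ∀ (n : ℕ) (G : SimpleGraph (Fin n)), P n G →
    ∃ (s : State) (t : ℕ), Runs c (graphInput G) s t ∧ t ≤ p.eval n ∧ s.var 0 = f n G

end RAM

/-!
# The VC-dimension of monophonic halfspaces

In a connected graph, a set `H` is a monophonic halfspace iff the ends in `H` of the edges between
`H` and its complement form a clique, and likewise the ends outside `H` (`isHalfspace_iff`).

*The bound.* Let four of the vertices of a shattered set be `s₁, s₂, s₃, s₄`. A halfspace that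
contains `s₁, s₃` and avoids `s₂, s₄` cuts an edge on an induced path from `s₁` to `s₂` and one on
an induced path from `s₃` to `s₄`. The ends `a` and `b` of these edges inside the halfspace are
adjacent, and every halfspace that contains `s₁, s₂` and avoids `s₃, s₄` contains `a` and avoids
`b` (`exists_separating_edge`). So the halfspaces of the edge `ab` shatter the remaining vertices.

*The structure of the halfspaces of an edge `ab`.* The clique conditions forbid certain
configurations on four vertices. Since `ab` is cut, the neighbours of only one of `a`, `b` are on
the side of that vertex, and all other ends of cut edges are common neighbours of `a` and `b`, so
that each condition reduces to one on two vertices: the halfspaces of `ab` are the models of a set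
of clauses with two literals (`models_clause_iff`). Contradictions between literals are then
binary, so a set is shattered iff its vertices are undecided and pairwise independent
(`TwoSat.shatters_iff`).

*Computing the VC-dimension.* A largest set of pairwise independent vertices is easy to find
because of the following property (`transGen_clause_reverse`): if `x` is independent of `y` and of
`z`, an implication from a literal on `y` to a literal on `z` can be reversed. Indeed `x` may be
assumed to be a common neighbour of `a` and `b`, and a clause that is not reversible as such comes
from a vertex `t` on the side of `a` (say) that is adjacent to the conclusion and not to the
premise; then `x` is implied by the premise or implies the conclusion, according to whether `x` is
adjacent to `t`. Hence dependence is an equivalence relation on the vertices independent of `x`,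
and the largest shattered sets through `x` have one vertex in each class
(`TwoSat.vcDim_eq_sup_leaders`).

*The algorithm.* For every edge, the program writes down the matrix of clauses, closes it under
transitivity by Warshall's algorithm, and counts for every `x` the smallest elements of the
classes. The predicates `RAM.Exec` and `RAM.Comp` say that a state transformation, or the
evaluation of a term, can be done by a program in polynomial time; their closure properties reduce
the correctness of the program to that of a function on states.
-/

/-! ### Monophonic halfspaces and their cuts -/

namespace Monophonic

open SimpleGraph

/-- A shortest walk among those inside the support of `p` is an induced path. -/
theorem exists_isPath_isChordless {V : Type*} {G : SimpleGraph V} {u v : V} (p : G.Walk u v) :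
    ∃ q : G.Walk u v, q.IsPath ∧ q.IsChordless ∧ q.support ⊆ p.support := by
  classical
  have hex : ∃ m, ∃ q : G.Walk u v, q.support ⊆ p.support ∧ q.length = m :=
    ⟨_, p, List.Subset.refl _, rfl⟩
  obtain ⟨q₀, hq₀, hlen₀⟩ := Nat.find_spec hex
  have hmin : ∀ q : G.Walk u v, q.support ⊆ p.support → Nat.find hex ≤ q.length :=
    fun q hq => Nat.find_min' hex ⟨q, hq, rfl⟩
  have hsub : q₀.bypass.support ⊆ p.support := fun x hx =>
    hq₀ (q₀.support_bypass_subset_support hx)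
  have hlen : ∀ q : G.Walk u v, q.support ⊆ p.support → q₀.bypass.length ≤ q.length := fun q hq =>
    (q₀.length_bypass_le_length.trans hlen₀.le).trans (hmin q hq)
  refine ⟨q₀.bypass, q₀.bypass_isPath, ?_, hsub⟩
  generalize q₀.bypass = q at hsub hlen
  -- A chord joining the positions `i < j` would give a shorter walk.
  have key : ∀ i j, i < j → j ≤ q.length → G.Adj (q.getVert i) (q.getVert j) → j = i + 1 := by
    intro i j hij hj hadj
    have h := hlen ((q.take i).append (.cons hadj (q.drop j))) (by
      intro x hx
      rw [Walk.mem_support_append_iff, Walk.support_cons, List.mem_cons] at hx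
      rcases hx with hx | rfl | hx
      · rw [Walk.support_take] at hx
        exact hsub (List.mem_of_mem_take hx)
      · exact hsub (q.getVert_mem_support i)
      · obtain ⟨k, rfl, -⟩ := Walk.mem_support_iff_exists_getVert.1 hx
        rw [Walk.drop_getVert]
        exact hsub (q.getVert_mem_support _))
    rw [Walk.length_append, Walk.length_cons, Walk.take_length, Walk.drop_length] at h
    omega
  rw [Walk.isChordless_iff_forall_mem_edges]
  intro x y hx hy hadj
  obtain ⟨i, rfl, hi⟩ := Walk.mem_support_iff_exists_getVert.1 hx
  obtain ⟨j, rfl, hj⟩ := Walk.mem_support_iff_exists_getVert.1 hy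
  rw [Walk.mk_mem_edges_iff_exists]
  rcases lt_trichotomy i j with h | rfl | h
  · obtain rfl := key i j h hj hadj
    exact ⟨i, by omega, rfl⟩
  · exact (hadj.ne rfl).elim
  · obtain rfl := key j i h hi hadj.symm
    exact ⟨j, by omega, Sym2.eq_swap⟩

theorem IsConvex.exists_walk {V : Type*} {G : SimpleGraph V} (hG : G.Connected) {S : Set V}
    (hS : IsConvex G S) {u v : V} (hu : u ∈ S) (hv : v ∈ S) :
    ∃ p : G.Walk u v, ∀ x ∈ p.support, x ∈ S := by
  obtain ⟨p⟩ := hG.preconnected u v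
  obtain ⟨q, hq, hq', -⟩ := exists_isPath_isChordless p
  exact ⟨q, fun x hx => hS u hu v hv ⟨q, hq, hq', hx⟩⟩

/-- The set of end vertices in `H` of the edges between `H` and its complement is a clique. -/
def CliqueBorder {V : Type*} (G : SimpleGraph V) (H : Set V) : Prop :=
  ∀ ⦃x x' y y'⦄, x ∈ H → x' ∈ H → y ∉ H → y' ∉ H → G.Adj x y → G.Adj x' y' → x ≠ x' → G.Adj x x'

/-- If `x` and `x'` were not adjacent, a shortest walk between them through the complement of `H`
would be an induced path that leaves `H`. -/
theorem cliqueBorder_of_isConvex {V : Type*} {G : SimpleGraph V} (hG : G.Connected) {H : Set V}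
    (hH : IsConvex G H) (hH' : IsConvex G Hᶜ) : CliqueBorder G H := by
  intro x x' y y' hx hx' hy hy' hxy hxy' hne
  by_contra hadj
  obtain ⟨p, hp⟩ := hH'.exists_walk hG hy hy'
  obtain ⟨q, hq, hq', hsub⟩ :=
    exists_isPath_isChordless (Walk.cons hxy (p.append (.cons hxy'.symm .nil)))
  -- The second vertex of `q` is neither `x` nor `x'`, so it lies outside `H`.
  have hlen : 1 < q.length := by
    by_contra h
    rcases Nat.lt_or_ge 0 q.length with h0 | h0
    · have h1 := q.adj_getVert_succ h0
      have : q.length = 1 := by omega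
      rw [Walk.getVert_zero, zero_add, ← this, Walk.getVert_length] at h1
      exact hadj h1
    · exact hne (Walk.eq_of_length_eq_zero (Nat.le_zero.1 h0))
  have hmem : q.getVert 1 ∈ q.support := q.getVert_mem_support 1
  have hin : q.getVert 1 ∈ H := hH x hx x' hx' ⟨q, hq, hq', hmem⟩
  have h0 : q.getVert 1 ≠ x := fun h => by
    have := hq.getVert_injOn (show (1 : ℕ) ≤ _ by omega) (show 0 ≤ q.length by omega)
      (h.trans q.getVert_zero.symm)
    omega
  have h1 : q.getVert 1 ≠ x' := fun h => by
    have := hq.getVert_injOn (show (1 : ℕ) ≤ _ by omega) (show q.length ≤ q.length by omega)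
      (h.trans q.getVert_length.symm)
    omega
  have := hsub hmem
  simp only [Walk.support_cons, Walk.mem_support_append_iff, List.mem_cons, Walk.support_nil,
    List.not_mem_nil, or_false] at this
  rcases this with h | h | h | h
  · exact h0 h
  · exact hp _ h hin
  · rw [h] at hin
    exact hy' hin
  · exact h1 h

/-- An induced path that leaves `H` and returns to it has nonadjacent vertices in the border. -/
theorem CliqueBorder.isConvex {V : Type*} {G : SimpleGraph V} {H : Set V}
    (hH : CliqueBorder G H) : IsConvex G H := by
  rintro u hu v hv z ⟨w, hw, hw', hz⟩
  by_contra hzH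
  obtain ⟨k, rfl, hk⟩ := Walk.mem_support_iff_exists_getVert.1 hz
  -- The path leaves `H` before and enters `H` after its vertex outside `H`.
  have hleave : ∃ i < k, w.getVert i ∈ H ∧ w.getVert (i + 1) ∉ H := by
    by_contra! h
    have : ∀ i ≤ k, w.getVert i ∈ H := by
      intro i
      induction i with
      | zero => intro _; simpa using hu
      | succ i ih => intro hi; exact h i (by omega) (ih (by omega))
    exact hzH (this k le_rfl)
  have henter : ∃ j, k ≤ j ∧ j < w.length ∧ w.getVert j ∉ H ∧ w.getVert (j + 1) ∈ H := by
    by_contra! h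
    have : ∀ i, k + i ≤ w.length → w.getVert (k + i) ∉ H := by
      intro i
      induction i with
      | zero => intro _; exact hzH
      | succ i ih => intro hi; exact h (k + i) (by omega) (by omega) (ih (by omega))
    have h' := this (w.length - k) (by omega)
    rw [Nat.add_sub_cancel' hk, Walk.getVert_length] at h'
    exact h' hv
  obtain ⟨i, hik, hi, hi'⟩ := hleave
  obtain ⟨j, hkj, hjl, hj, hj'⟩ := henter
  have hinj : ∀ {s t}, s ≤ w.length → t ≤ w.length → w.getVert s = w.getVert t → s = t :=
    fun hs ht h => hw.getVert_injOn hs ht h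
  have hne : w.getVert i ≠ w.getVert (j + 1) := fun h => by
    have := hinj (by omega) (by omega) h
    omega
  have hadj := hH hi hj' hi' hj (w.adj_getVert_succ (by omega)) (w.adj_getVert_succ hjl).symm hne
  have hedge := hw'.mem_edges (w.getVert_mem_support _) (w.getVert_mem_support _) hadj
  obtain ⟨m, hm, h⟩ := (Walk.mk_mem_edges_iff_exists w).1 hedge
  rw [Sym2.eq_iff] at h
  rcases h with ⟨h1, h2⟩ | ⟨h1, h2⟩
  all_goals
    have e1 := hinj (by omega) (by omega) h1
    have e2 := hinj (by omega) (by omega) h2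
    omega

theorem isHalfspace_iff {V : Type*} {G : SimpleGraph V} (hG : G.Connected) {H : Set V} :
    IsHalfspace G H ↔ CliqueBorder G H ∧ CliqueBorder G Hᶜ := by
  constructor
  · rintro ⟨h, h'⟩
    exact ⟨cliqueBorder_of_isConvex hG h h',
      cliqueBorder_of_isConvex hG h' (by rwa [compl_compl])⟩
  · rintro ⟨h, h'⟩
    exact ⟨h.isConvex, h'.isConvex⟩

theorem mem_halfspaces {V : Type*} [Fintype V] {G : SimpleGraph V} {H : Finset V} :
    H ∈ halfspaces G ↔ IsHalfspace G (H : Set V) := by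
  simp [halfspaces]

theorem mem_edgeHalfspaces {V : Type*} [Fintype V] [DecidableEq V] {G : SimpleGraph V} {a b : V}
    {H : Finset V} : H ∈ edgeHalfspaces G a b ↔ H ∈ halfspaces G ∧ a ∈ H ∧ b ∉ H := by
  simp [edgeHalfspaces]

/-! ### The VC-dimension of all halfspaces -/

theorem vcDim_le_maxEdgeVCDim {V : Type*} [Fintype V] [DecidableEq V] {G : SimpleGraph V} {a b : V}
    (h : G.Adj a b) : (edgeHalfspaces G a b).vcDim ≤ maxEdgeVCDim G := by
  classical
  exact Finset.le_sup (f := fun e : V × V => (edgeHalfspaces G e.1 e.2).vcDim) (b := (a, b))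
    (by simpa using h)

theorem maxEdgeVCDim_le_vcDim_halfspaces {V : Type*} [Fintype V] [DecidableEq V]
    (G : SimpleGraph V) : maxEdgeVCDim G ≤ (halfspaces G).vcDim := by
  classical
  exact Finset.sup_le fun e _ => Finset.vcDim_mono (Finset.filter_subset _ _)

/-- If the four vertices `s₁, s₂, s₃, s₄` are shattered, some edge `ab` has `a` in the convex hull
of `s₁, s₂` and `b` in that of `s₃, s₄`: take a halfspace that contains `s₁, s₃` and avoids
`s₂, s₄`, and edges that it cuts on induced paths from `s₁` to `s₂` and from `s₃` to `s₄`. -/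
theorem exists_separating_edge {V : Type*} {G : SimpleGraph V} (hG : G.Connected)
    {s₁ s₂ s₃ s₄ : V} {A B : Set V} (hA : IsHalfspace G A) (hB : IsHalfspace G B)
    (hA₁ : s₁ ∈ A) (hA₂ : s₂ ∈ A) (hA₃ : s₃ ∉ A) (hA₄ : s₄ ∉ A)
    (hB₁ : s₁ ∈ B) (hB₂ : s₂ ∉ B) (hB₃ : s₃ ∈ B) (hB₄ : s₄ ∉ B) :
    ∃ a b, G.Adj a b ∧ ∀ H, IsHalfspace G H → s₁ ∈ H → s₂ ∈ H → s₃ ∉ H → s₄ ∉ H →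
      a ∈ H ∧ b ∉ H := by
  obtain ⟨p⟩ := hG.preconnected s₁ s₂
  obtain ⟨p, hp, hp', -⟩ := exists_isPath_isChordless p
  obtain ⟨q⟩ := hG.preconnected s₃ s₄
  obtain ⟨q, hq, hq', -⟩ := exists_isPath_isChordless q
  obtain ⟨d, hd, hd₁, hd₂⟩ := p.exists_boundary_dart B hB₁ hB₂
  obtain ⟨e, he, he₁, he₂⟩ := q.exists_boundary_dart B hB₃ hB₄
  have hull : ∀ H, IsHalfspace G H → s₁ ∈ H → s₂ ∈ H → s₃ ∉ H → s₄ ∉ H →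
      d.fst ∈ H ∧ e.fst ∉ H := fun H hH h₁ h₂ h₃ h₄ =>
    ⟨hH.1 _ h₁ _ h₂ ⟨p, hp, hp', p.dart_fst_mem_support_of_mem_darts hd⟩,
      hH.2 _ h₃ _ h₄ ⟨q, hq, hq', q.dart_fst_mem_support_of_mem_darts he⟩⟩
  refine ⟨d.fst, e.fst, ?_, hull⟩
  have hAde := hull A hA hA₁ hA₂ hA₃ hA₄
  exact ((isHalfspace_iff hG).1 hB).1 hd₁ he₁ hd₂ he₂ d.adj e.adj
    fun h => hAde.2 (h ▸ hAde.1)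

theorem vcDim_halfspaces_le {V : Type*} [Fintype V] [DecidableEq V] {G : SimpleGraph V}
    (hG : G.Connected) : (halfspaces G).vcDim ≤ maxEdgeVCDim G + 4 := by
  refine Finset.sup_le fun S hS => ?_
  rw [Finset.mem_shatterer] at hS
  rcases Nat.lt_or_ge S.card 4 with h4 | h4
  · omega
  obtain ⟨T, hTS, hT⟩ := Finset.exists_subset_card_eq h4
  obtain ⟨s₁, s₂, s₃, s₄, h₁₂, h₁₃, h₁₄, h₂₃, h₂₄, h₃₄, rfl⟩ := Finset.card_eq_four.1 hT
  have hm₁ : s₁ ∈ S := hTS (by simp)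
  have hm₂ : s₂ ∈ S := hTS (by simp)
  have hm₃ : s₃ ∈ S := hTS (by simp)
  have hm₄ : s₄ ∈ S := hTS (by simp)
  have trace : ∀ R ⊆ S, ∃ H : Finset V, IsHalfspace G (H : Set V) ∧ ∀ x ∈ S, x ∈ H ↔ x ∈ R := by
    intro R hR
    obtain ⟨H, hH, rfl⟩ := hS hR
    exact ⟨H, mem_halfspaces.1 hH, fun x hx => by simp [hx]⟩
  obtain ⟨A, hA, hA'⟩ := trace {s₁, s₂} (by simp [Finset.insert_subset_iff, *])
  obtain ⟨B, hB, hB'⟩ := trace {s₁, s₃} (by simp [Finset.insert_subset_iff, *])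
  obtain ⟨a, b, hab, hsep⟩ := exists_separating_edge hG (s₁ := s₁) (s₂ := s₂) (s₃ := s₃) (s₄ := s₄)
    hA hB
    (by simp [hA' _ hm₁]) (by simp [hA' _ hm₂])
    (by simp [hA' _ hm₃, h₁₃.symm, h₂₃.symm]) (by simp [hA' _ hm₄, h₁₄.symm, h₂₄.symm])
    (by simp [hB' _ hm₁]) (by simp [hB' _ hm₂, h₁₂.symm, h₂₃])
    (by simp [hB' _ hm₃]) (by simp [hB' _ hm₄, h₁₄.symm, h₃₄.symm])
  have hshat : (edgeHalfspaces G a b).Shatters (S \ {s₁, s₂, s₃, s₄}) := by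
    intro R hR
    have hR' : ∀ x ∈ R, x ∈ S ∧ x ≠ s₁ ∧ x ≠ s₂ ∧ x ≠ s₃ ∧ x ≠ s₄ := by
      intro x hx
      simpa using hR hx
    obtain ⟨H, hH, hH'⟩ := trace (R ∪ {s₁, s₂}) (by
      refine Finset.union_subset (fun x hx => (hR' x hx).1) ?_
      simp [Finset.insert_subset_iff, *])
    have h₃R : s₃ ∉ R := fun h => (hR' _ h).2.2.2.1 rfl
    have h₄R : s₄ ∉ R := fun h => (hR' _ h).2.2.2.2 rfl
    refine ⟨H, mem_edgeHalfspaces.2 ⟨mem_halfspaces.2 hH, hsep H hH ?_ ?_ ?_ ?_⟩, ?_⟩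
    · simp [hH' _ hm₁]
    · simp [hH' _ hm₂]
    · simp [hH' _ hm₃, h₃R, h₁₃.symm, h₂₃.symm]
    · simp [hH' _ hm₄, h₄R, h₁₄.symm, h₂₄.symm]
    · ext x
      simp only [Finset.mem_inter, Finset.mem_sdiff, Finset.mem_insert, Finset.mem_singleton]
      constructor
      · rintro ⟨⟨hxS, hxT⟩, hxH⟩
        have := (hH' x hxS).1 hxH
        simp only [Finset.mem_union, Finset.mem_insert, Finset.mem_singleton] at this
        tauto
      · intro hx
        have := hR' x hx
        exact ⟨⟨this.1, by tauto⟩, (hH' x this.1).2 (by simp [hx])⟩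
  have := hshat.card_le_vcDim.trans (vcDim_le_maxEdgeVCDim hab)
  rw [Finset.card_sdiff_of_subset hTS, hT] at this
  omega

end Monophonic

/-! ### Families defined by clauses with two literals -/

namespace TwoSat

open Relation

/-- The complement of a literal. A literal `(x, true)` says that `x` belongs to the set, and
`(x, false)` that it does not. -/
def neg {V : Type*} (l : V × Bool) : V × Bool := (l.1, !l.2)

@[simp] theorem neg_neg {V : Type*} (l : V × Bool) : neg (neg l) = l := by simp [neg]

@[simp] theorem neg_mk {V : Type*} (x : V) (σ : Bool) : neg (x, σ) = (x, !σ) := rfl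

theorem neg_ne {V : Type*} (l : V × Bool) : neg l ≠ l := fun h => by
  simpa [neg] using congrArg Prod.snd h

/-- The literal `l` is true of the set `H`. -/
def Holds {V : Type*} (H : Finset V) (l : V × Bool) : Prop := l.1 ∈ H ↔ l.2 = true

theorem holds_neg {V : Type*} {H : Finset V} {l : V × Bool} : Holds H (neg l) ↔ ¬ Holds H l := by
  rcases l with ⟨x, _ | _⟩ <;> simp [Holds, neg]

/-- A set of implications between literals is closed under contraposition. -/
def Skew {V : Type*} (I : V × Bool → V × Bool → Prop) : Prop := ∀ ⦃l m⦄, I l m → I (neg m) (neg l)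

/-- The set `H` satisfies all implications in `I`. -/
def Models {V : Type*} (I : V × Bool → V × Bool → Prop) (H : Finset V) : Prop :=
  ∀ l m, I l m → Holds H l → Holds H m

/-- No vertex is forced both in and out. -/
def Sat {V : Type*} (I : V × Bool → V × Bool → Prop) : Prop :=
  ∀ x, ¬ (TransGen I (x, true) (x, false) ∧ TransGen I (x, false) (x, true))

/-- The implications do not decide whether `x` belongs to the set. -/
def Free {V : Type*} (I : V × Bool → V × Bool → Prop) (x : V) : Prop :=
  ¬ TransGen I (x, true) (x, false) ∧ ¬ TransGen I (x, false) (x, true)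

/-- No literal on `x` implies a literal on `y`. -/
def Indep {V : Type*} (I : V × Bool → V × Bool → Prop) (x y : V) : Prop :=
  ∀ σ τ, ¬ TransGen I (x, σ) (y, τ)

section

variable {V : Type*} {I : V × Bool → V × Bool → Prop}

theorem Skew.transGen (hI : Skew I) {l m : V × Bool} (h : TransGen I l m) :
    TransGen I (neg m) (neg l) := by
  induction h with
  | single h => exact .single (hI h)
  | tail _ h ih => exact .head (hI h) ih

theorem Skew.reflTransGen (hI : Skew I) {l m : V × Bool} (h : ReflTransGen I l m) :
    ReflTransGen I (neg m) (neg l) := by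
  induction h with
  | refl => exact .refl
  | tail _ h ih => exact .head (hI h) ih

theorem Free.not_transGen_neg {l : V × Bool} (h : Free I l.1) : ¬ TransGen I l (neg l) := by
  rcases l with ⟨x, _ | _⟩
  · exact h.2
  · exact h.1

theorem free_iff {x : V} : Free I x ↔ ∀ σ, ¬ TransGen I (x, σ) (x, !σ) := by
  simp [Free, and_comm]

theorem Indep.symm (hI : Skew I) {x y : V} (h : Indep I x y) : Indep I y x := fun σ τ hT =>
  h (!τ) (!σ) (by simpa using hI.transGen hT)

theorem Models.of_reflTransGen {H : Finset V} (hH : Models I H) {l m : V × Bool}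
    (h : ReflTransGen I l m) (hl : Holds H l) : Holds H m := by
  induction h with
  | refl => exact hl
  | tail _ h ih => exact hH _ _ h ih

theorem Models.of_transGen {H : Finset V} (hH : Models I H) {l m : V × Bool}
    (h : TransGen I l m) (hl : Holds H l) : Holds H m :=
  hH.of_reflTransGen h.to_reflTransGen hl

/-- A set of literals extends to a model if no two of them are contradictory: a maximal such set
contains one of any two complementary literals. -/
theorem Sat.exists_models [Finite V] (hI : Skew I) (hsat : Sat I) {L : Set (V × Bool)}
    (hL : ∀ p ∈ L, ∀ q ∈ L, ¬ ReflTransGen I p (neg q)) :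
    ∃ H, Models I H ∧ ∀ l ∈ L, Holds H l := by
  classical
  have := Fintype.ofFinite V
  obtain ⟨M, hLM, hM⟩ := Finite.exists_le_maximal
    (p := fun M : Set (V × Bool) => ∀ p ∈ M, ∀ q ∈ M, ¬ ReflTransGen I p (neg q)) hL
  have hcons := hM.prop
  have hconf : ∀ l, l ∉ M →
      ReflTransGen I l (neg l) ∨ ∃ p ∈ M, ReflTransGen I p (neg l) := by
    intro l hl
    by_contra! hcon
    refine hl (hM.le_of_ge (y := insert l M) ?_ (Set.subset_insert _ _) (Set.mem_insert _ _))
    rintro p (rfl | hp) q (rfl | hq)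
    · exact hcon.1
    · intro h
      exact hcon.2 q hq (by simpa using hI.reflTransGen h)
    · exact hcon.2 p hp
    · exact hcons p hp q hq
  have hself : ∀ l, ¬ (ReflTransGen I l (neg l) ∧ ReflTransGen I (neg l) l) := by
    rintro l ⟨h, h'⟩
    have h := (reflTransGen_iff_eq_or_transGen.1 h).resolve_left (neg_ne l)
    have h' := (reflTransGen_iff_eq_or_transGen.1 h').resolve_left (neg_ne l).symm
    rcases l with ⟨x, _ | _⟩
    · exact hsat x ⟨h', h⟩
    · exact hsat x ⟨h, h'⟩
  have hcompl : ∀ l, l ∈ M ∨ neg l ∈ M := by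
    intro l
    by_contra! hcon
    have h₁ := hconf l hcon.1
    have h₂ := hconf (neg l) hcon.2
    rw [neg_neg] at h₂
    rcases h₁ with h₁ | ⟨p, hp, h₁⟩ <;> rcases h₂ with h₂ | ⟨q, hq, h₂⟩
    · exact hself l ⟨h₁, h₂⟩
    · exact hcons q hq q hq (h₂.trans (h₁.trans (hI.reflTransGen h₂)))
    · have h₃ := hI.reflTransGen h₁
      rw [neg_neg] at h₃
      exact hcons p hp p hp (h₁.trans (h₂.trans h₃))
    · have h₃ := hI.reflTransGen h₁
      rw [neg_neg] at h₃
      exact hcons q hq p hp (h₂.trans h₃)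
  have hholds : ∀ l, Holds (Finset.univ.filter fun x => (x, true) ∈ M) l ↔ l ∈ M := by
    rintro ⟨x, _ | _⟩
    · have h₁ := hcompl (x, true)
      have h₂ : (x, true) ∈ M → (x, false) ∈ M → False := fun h h' => hcons _ h _ h' .refl
      simp only [Holds, Finset.mem_filter, Finset.mem_univ, true_and, Bool.false_eq_true, iff_false]
      exact ⟨fun h => h₁.resolve_left h, fun h h' => h₂ h' h⟩
    · simp [Holds]
  refine ⟨_, fun l m hlm hl => ?_, fun l hl => (hholds l).2 (hLM hl)⟩
  rw [hholds] at hl ⊢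
  refine (hcompl m).resolve_right fun hm => hcons l hl _ hm ?_
  rw [neg_neg]
  exact .single hlm

/-- As contradictions between literals are binary, a set is shattered if its pairs are. -/
theorem shatters_iff [Finite V] [DecidableEq V] (hI : Skew I) {𝒜 : Finset (Finset V)}
    (h𝒜 : ∀ H, H ∈ 𝒜 ↔ Models I H) {S : Finset V} :
    𝒜.Shatters S ↔ Sat I ∧ (∀ x ∈ S, Free I x) ∧ ∀ x ∈ S, ∀ y ∈ S, x ≠ y → Indep I x y := by
  constructor
  · intro hS
    have hmodel : ∀ x ∈ S, ∀ σ, ∃ H, Models I H ∧ Holds H (x, σ) := by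
      rintro x hx (_ | _)
      · obtain ⟨H, hH, h⟩ := hS (Finset.empty_subset S)
        refine ⟨H, (h𝒜 H).1 hH, ?_⟩
        have : x ∉ H := fun hxH => by simpa [h] using Finset.mem_inter.2 ⟨hx, hxH⟩
        simpa [Holds] using this
      · obtain ⟨H, hH, h⟩ := hS (subset_refl S)
        refine ⟨H, (h𝒜 H).1 hH, ?_⟩
        have : x ∈ H := (Finset.mem_inter.1 (h.symm ▸ hx : x ∈ S ∩ H)).2
        simpa [Holds] using this
    refine ⟨?_, ?_, ?_⟩
    · rintro x ⟨h, h'⟩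
      obtain ⟨H, hH⟩ := hS.nonempty
      have hH := (h𝒜 H).1 hH
      have := hH.of_transGen h
      have := hH.of_transGen h'
      by_cases hx : x ∈ H <;> simp_all [Holds]
    · intro x hx
      rw [free_iff]
      intro σ hT
      obtain ⟨H, hH, h⟩ := hmodel x hx σ
      exact holds_neg.1 (hH.of_transGen hT h) h
    · intro x hx y hy hxy σ τ hT
      -- A model in which the first literal holds and the second fails.
      obtain ⟨H, hH, h⟩ := hS (t := S.filter fun z => (z = x ∧ σ = true) ∨ (z = y ∧ τ = false))
        (Finset.filter_subset _ _)
      have hmem : ∀ z ∈ S, z ∈ H ↔ (z = x ∧ σ = true) ∨ (z = y ∧ τ = false) := by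
        intro z hz
        have := congrArg (z ∈ ·) h
        simpa [hz] using this
      have h₁ : Holds H (x, σ) := by simp [Holds, hmem x hx, hxy]
      have h₂ : ¬ Holds H (y, τ) := by
        simp [Holds, hmem y hy, hxy.symm]
      exact h₂ (((h𝒜 H).1 hH).of_transGen hT h₁)
  · rintro ⟨hsat, hfree, hindep⟩ R hR
    obtain ⟨H, hH, hL⟩ := hsat.exists_models hI
      (L := {l | l.1 ∈ S ∧ (l.1 ∈ R ↔ l.2 = true)}) (by
        rintro ⟨x, σ⟩ ⟨hx, hσ⟩ ⟨y, τ⟩ ⟨hy, hτ⟩ hT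
        simp only at hx hσ hy hτ
        rcases reflTransGen_iff_eq_or_transGen.1 hT with h | h
        · simp only [neg_mk, Prod.mk.injEq] at h
          obtain ⟨rfl, rfl⟩ := h
          rw [hτ] at hσ
          cases τ <;> simp at hσ
        · rcases eq_or_ne x y with rfl | hxy
          · have : σ = τ := by
              rw [hσ] at hτ
              exact Bool.eq_iff_iff.2 hτ
            subst this
            exact (hfree x hx).not_transGen_neg h
          · exact hindep x hx y hy hxy _ _ h)
    refine ⟨H, (h𝒜 H).2 hH, ?_⟩
    ext x
    rw [Finset.mem_inter]
    constructor
    · rintro ⟨hxS, hxH⟩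
      by_contra hxR
      have := hL (x, false) ⟨hxS, by simpa using hxR⟩
      simp [Holds, hxH] at this
    · intro hxR
      have := hL (x, true) ⟨hR hxR, by simpa using hxR⟩
      exact ⟨hR hxR, by simpa [Holds] using this⟩

/-- Suppose that every implication between literals can be reversed, unless a fixed vertex `w` is
comparable with its ends. Then the same is true for chains of implications. -/
theorem transGen_reverse (hI : Skew I) {w : V}
    (hstep : ∀ l m, I l m → Free I l.1 → Free I m.1 →
      TransGen I m l ∨ ∃ ω, TransGen I l (w, ω) ∨ TransGen I (w, ω) m)
    {l m : V × Bool} (hl : Free I l.1) (hm : Free I m.1) (hlw : Indep I l.1 w)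
    (hwm : Indep I w m.1) (h : TransGen I l m) : TransGen I m l := by
  have hfree : ∀ c, ReflTransGen I l c → ReflTransGen I c m → Free I c.1 := by
    intro c hlc hcm
    have h₁ : ¬ TransGen I c (neg c) := fun hT => hl.not_transGen_neg
      ((TransGen.trans_right hlc hT).trans_left (hI.reflTransGen hlc))
    have h₂ : ¬ TransGen I (neg c) c := fun hT => hm.not_transGen_neg (l := neg m) (by
      rw [neg_neg]
      exact (TransGen.trans_right (hI.reflTransGen hcm) hT).trans_left hcm)
    rcases c with ⟨x, _ | _⟩
    · exact ⟨h₂, h₁⟩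
    · exact ⟨h₁, h₂⟩
  -- A step of the chain is reversible, since otherwise `w` would be comparable with an end.
  have hone : ∀ c d, ReflTransGen I l c → I c d → ReflTransGen I d m → TransGen I d c := by
    intro c d hlc hcd hdm
    refine (hstep c d hcd (hfree c hlc (.head hcd hdm)) (hfree d (hlc.tail hcd) hdm)).resolve_right
      ?_
    rintro ⟨ω, h | h⟩
    · exact hlw _ _ (TransGen.trans_right hlc h)
    · exact hwm _ _ (TransGen.trans_left h hdm)
  have main : ∀ d, TransGen I l d → ReflTransGen I d m → TransGen I d l := by
    intro d hd
    induction hd with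
    | single h => exact fun hdm => hone _ _ .refl h hdm
    | tail hlc hcd ih =>
      exact fun hdm => (hone _ _ hlc.to_reflTransGen hcd hdm).trans (ih (.head hcd hdm))
  exact main m h .refl

end

/-! ### Counting a largest shattered set -/

section

variable {n : ℕ} {I : Fin n × Bool → Fin n × Bool → Prop}

/-- The vertex `y` is undecided, and equal to `x` or independent of `x`. -/
def Near (I : Fin n × Bool → Fin n × Bool → Prop) (x y : Fin n) : Prop :=
  Sat I ∧ Free I x ∧ Free I y ∧ (y = x ∨ Indep I x y)

/-- The vertex `y` is near `x` and independent of all smaller vertices near `x`. -/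
def IsLeader (I : Fin n × Bool → Fin n × Bool → Prop) (x y : Fin n) : Prop :=
  Near I x y ∧ ∀ z, z < y → Near I x z → Indep I z y

/-- If implications can be reversed among the vertices independent of `x`, then dependence is an
equivalence relation on these vertices, so that picking one vertex of each class gives a largest
shattered set through `x`. -/
theorem vcDim_eq_sup_leaders (hI : Skew I) {𝒜 : Finset (Finset (Fin n))}
    (h𝒜 : ∀ H, H ∈ 𝒜 ↔ Models I H)
    (hrev : ∀ x l m, Free I x → Free I l.1 → Free I m.1 → Indep I x l.1 → Indep I x m.1 →
      TransGen I l m → TransGen I m l) [∀ x, DecidablePred (IsLeader I x)] :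
    𝒜.vcDim = Finset.univ.sup fun x => (Finset.univ.filter (IsLeader I x)).card := by
  classical
  apply le_antisymm
  · refine Finset.sup_le fun S hS => ?_
    rw [Finset.mem_shatterer, shatters_iff hI h𝒜] at hS
    obtain ⟨hsat, hfree, hindep⟩ := hS
    rcases S.eq_empty_or_nonempty with rfl | ⟨x, hx⟩
    · simp
    refine le_trans ?_ (Finset.le_sup (Finset.mem_univ x))
    have hnear : ∀ s ∈ S, Near I x s := fun s hs => ⟨hsat, hfree x hx, hfree s hs, by
      by_cases h : s = x
      · exact Or.inl h
      · exact Or.inr (hindep x hx s hs (Ne.symm h))⟩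
    have htrans : ∀ u v w, Near I x u → Near I x v → Near I x w →
        (u = v ∨ ¬ Indep I u v) → (v = w ∨ ¬ Indep I v w) → (u = w ∨ ¬ Indep I u w) := by
      intro u v w hu hv hw huv hvw
      rcases huv with rfl | huv
      · exact hvw
      rcases hvw with rfl | hvw
      · exact Or.inr huv
      have hu' : Indep I x u ∨ u = x := hu.2.2.2.symm
      have hv' : Indep I x v ∨ v = x := hv.2.2.2.symm
      have hw' : Indep I x w ∨ w = x := hw.2.2.2.symm
      rcases hv' with hv' | rfl
      · rcases hu' with hu' | rfl
        · rcases hw' with hw' | rfl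
          · right
            intro hind
            simp only [Indep, not_forall, not_not] at huv hvw
            obtain ⟨σ, τ, h⟩ := huv
            obtain ⟨σ', τ', h'⟩ := hvw
            by_cases hστ : σ' = τ
            · subst hστ
              exact hind _ _ (h.trans h')
            · have : σ' = !τ := by cases σ' <;> cases τ <;> simp_all
              subst this
              exact hind _ _
                ((hI.transGen (hrev x _ _ hu.2.1 hu.2.2.1 hv.2.2.1 hu' hv' h)).trans h')
          · exact (hvw (hv'.symm hI)).elim
        · exact (huv hv').elim
      · rcases hu' with hu' | rfl
        · exact (huv (hu'.symm hI)).elim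
        · rcases hw' with hw' | rfl
          · exact (hvw hw').elim
          · exact Or.inl rfl
    have hsymm : ∀ u v, (u = v ∨ ¬ Indep I u v) → (v = u ∨ ¬ Indep I v u) := by
      rintro u v (rfl | h)
      · exact Or.inl rfl
      · exact Or.inr fun h' => h (h'.symm hI)
    -- Each element of `S` is sent to the leader of its class.
    have hleader : ∀ s ∈ S, ∃ y, IsLeader I x y ∧ (y = s ∨ ¬ Indep I y s) := by
      intro s hs
      have hne : (Finset.univ.filter fun y => Near I x y ∧ (y = s ∨ ¬ Indep I y s)).Nonempty :=
        ⟨s, by simpa using hnear s hs⟩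
      have hmem := Finset.min'_mem _ hne
      rw [Finset.mem_filter] at hmem
      refine ⟨_, ⟨hmem.2.1, fun z hz hxz => ?_⟩, hmem.2.2⟩
      by_contra hzy
      refine absurd (Finset.min'_le _ z ?_) (not_le.2 hz)
      rw [Finset.mem_filter]
      exact ⟨Finset.mem_univ _, hxz,
        htrans z _ s hxz hmem.2.1 (hnear s hs) (Or.inr hzy) hmem.2.2⟩
    choose! f hf hf' using hleader
    refine Finset.card_le_card_of_injOn f (fun s hs => by simpa using hf s hs) ?_
    intro s hs t ht hst
    by_contra hne
    have h := htrans s (f s) t (hnear s hs) (hf s hs).1 (hnear t ht) (hsymm _ _ (hf' s hs))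
      (hst ▸ hf' t ht)
    exact h.elim hne fun h => h (hindep s hs t ht hne)
  · refine Finset.sup_le fun x _ => ?_
    rcases (Finset.univ.filter (IsLeader I x)).eq_empty_or_nonempty with h | ⟨y, hy⟩
    · simp [h]
    · have hsat : Sat I := (Finset.mem_filter.1 hy).2.1.1
      refine Finset.Shatters.card_le_vcDim ((shatters_iff hI h𝒜).2 ⟨hsat, ?_, ?_⟩)
      · intro z hz
        exact (Finset.mem_filter.1 hz).2.1.2.2.1
      · intro u hu v hv huv
        have hu := (Finset.mem_filter.1 hu).2
        have hv := (Finset.mem_filter.1 hv).2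
        rcases lt_or_gt_of_ne huv with h | h
        · exact hv.2 u h hu.1
        · exact (hu.2 v h hv.1).symm hI

end

end TwoSat

/-! ### The clauses of an edge -/

namespace Monophonic

open SimpleGraph TwoSat Relation

/-- The literals decided by the edge `ab`: the neighbours of `a` that are not neighbours of `b` lie
on the side of `a`, and conversely. -/
def Forced {V : Type*} (G : SimpleGraph V) (a b : V) : V × Bool → Prop
  | (x, true) => x = a ∨ G.Adj a x ∧ ¬ G.Adj b x ∧ x ≠ b
  | (x, false) => x = b ∨ G.Adj b x ∧ ¬ G.Adj a x ∧ x ≠ a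

/-- The edges `xy` and `x'y'` cannot both be cut with `x`, `x'` on the same side. -/
def Clash {V : Type*} (G : SimpleGraph V) (x x' y y' : V) : Prop :=
  G.Adj x y ∧ G.Adj x' y' ∧ (x ≠ x' ∧ ¬ G.Adj x x' ∨ y ≠ y' ∧ ¬ G.Adj y y')

/-- The literal `r` is `p` or `q` or decided by the edge `ab`. -/
def Given {V : Type*} (G : SimpleGraph V) (a b : V) (p q r : V × Bool) : Prop :=
  r = p ∨ r = q ∨ Forced G a b r

/-- The literals `p`, `q` and those decided by the edge `ab` cut two clashing edges. -/
def Conflict {V : Type*} (G : SimpleGraph V) (a b : V) (p q : V × Bool) : Prop :=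
  ∃ x x' y y', Clash G x x' y y' ∧ Given G a b p q (x, true) ∧ Given G a b p q (x', true) ∧
    Given G a b p q (y, false) ∧ Given G a b p q (y', false)

/-- The implications between two literals that define the halfspaces cutting the edge `ab`. -/
def Clause {V : Type*} (G : SimpleGraph V) (a b : V) (l m : V × Bool) : Prop :=
  Forced G a b (neg l) ∨ Forced G a b m ∨ Conflict G a b l (neg m)

section

variable {V : Type*} {G : SimpleGraph V} {a b : V}

theorem Clash.flip {x x' y y' : V} (h : Clash G x x' y y') : Clash G y y' x x' :=
  ⟨h.1.symm, h.2.1.symm, h.2.2.symm⟩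

theorem forced_flip {l : V × Bool} : Forced G b a (neg l) ↔ Forced G a b l := by
  rcases l with ⟨x, _ | _⟩ <;> rfl

theorem given_swap {p q r : V × Bool} : Given G a b p q r ↔ Given G a b q p r := by
  unfold Given; tauto

theorem given_flip {p q r : V × Bool} :
    Given G b a (neg p) (neg q) (neg r) ↔ Given G a b p q r := by
  have h : ∀ s : V × Bool, neg r = neg s ↔ r = s := fun s =>
    ⟨fun h => by simpa using congrArg neg h, fun h => by rw [h]⟩
  unfold Given
  rw [h, h, forced_flip]

theorem Conflict.symm {p q : V × Bool} (h : Conflict G a b p q) : Conflict G a b q p := by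
  obtain ⟨x, x', y, y', h, h₁, h₂, h₃, h₄⟩ := h
  exact ⟨x, x', y, y', h, given_swap.1 h₁, given_swap.1 h₂, given_swap.1 h₃, given_swap.1 h₄⟩

theorem Conflict.flip {p q : V × Bool} (h : Conflict G a b p q) :
    Conflict G b a (neg p) (neg q) := by
  obtain ⟨x, x', y, y', h, h₁, h₂, h₃, h₄⟩ := h
  exact ⟨y, y', x, x', h.flip, given_flip.2 h₃, given_flip.2 h₄, given_flip.2 h₁, given_flip.2 h₂⟩

theorem skew_clause : Skew (Clause G a b) := by
  rintro l m (h | h | h)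
  · exact Or.inr (Or.inl h)
  · exact Or.inl (by rwa [neg_neg])
  · refine Or.inr (Or.inr ?_)
    rw [neg_neg]
    exact h.symm

theorem Clause.flip {l m : V × Bool} (h : Clause G a b l m) : Clause G b a (neg l) (neg m) := by
  rcases h with h | h | h
  · exact Or.inl (forced_flip.2 h)
  · exact Or.inr (Or.inl (forced_flip.2 h))
  · exact Or.inr (Or.inr h.flip)

theorem transGen_clause_flip {l m : V × Bool} (h : TransGen (Clause G a b) l m) :
    TransGen (Clause G b a) (neg l) (neg m) := by
  induction h with
  | single h => exact .single h.flip
  | tail _ h ih => exact ih.tail h.flip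

theorem Conflict.clause {p q : V × Bool} (h : Conflict G a b p q) : Clause G a b p (neg q) :=
  Or.inr (Or.inr (by rwa [neg_neg]))

theorem forced_fst : Forced G a b (a, true) := Or.inl rfl

theorem forced_snd : Forced G a b (b, false) := Or.inl rfl

theorem Forced.not_forced_neg (hab : G.Adj a b) {l : V × Bool} (h : Forced G a b l) :
    ¬ Forced G a b (neg l) := by
  have := hab.ne
  have := hab.symm
  rcases l with ⟨x, _ | _⟩ <;> rintro (h' | h') <;> rcases h with h | h <;> simp_all

theorem Forced.not_free {l : V × Bool} (h : Forced G a b l) : ¬ Free (Clause G a b) l.1 :=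
  fun hf => hf.not_transGen_neg (l := neg l) (.single (Or.inr (Or.inl (by rwa [neg_neg]))))

theorem Forced.not_free_neg {l : V × Bool} (h : Forced G a b (neg l)) :
    ¬ Free (Clause G a b) l.1 := h.not_free

/-! ### Halfspaces as models of the clauses -/

theorem isHalfspace_iff_clash (hG : G.Connected) {H : Set V} :
    IsHalfspace G H ↔ ∀ x x' y y', Clash G x x' y y' → x ∈ H → x' ∈ H → y ∉ H → y' ∈ H := by
  rw [isHalfspace_iff hG]
  constructor
  · rintro ⟨h₁, h₂⟩ x x' y y' ⟨hxy, hxy', h | h⟩ hx hx' hy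
    · by_contra hy'
      exact h.2 (h₁ hx hx' hy hy' hxy hxy' h.1)
    · by_contra hy'
      exact h.2 (h₂ hy hy' (not_not_intro hx) (not_not_intro hx') hxy.symm hxy'.symm h.1)
  · intro h
    constructor
    · intro x x' y y' hx hx' hy hy' hxy hxy' hne
      by_contra hadj
      exact hy' (h x x' y y' ⟨hxy, hxy', Or.inl ⟨hne, hadj⟩⟩ hx hx' hy)
    · intro y y' x x' hy hy' hx hx' hxy hxy' hne
      by_contra hadj
      exact hy' (h x x' y y' ⟨hxy.symm, hxy'.symm, Or.inr ⟨hne, hadj⟩⟩ (not_not.1 hx)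
        (not_not.1 hx') hy)

theorem holds_of_forced (hab : G.Adj a b) {H : Finset V} (ha : a ∈ H) (hb : b ∉ H)
    (hH : ∀ x x' y y', Clash G x x' y y' → x ∈ H → x' ∈ H → y ∉ H → y' ∈ H) {l : V × Bool}
    (hl : Forced G a b l) : Holds H l := by
  rcases l with ⟨x, _ | _⟩ <;> rcases hl with rfl | ⟨h₁, h₂, h₃⟩
  · simpa [Holds] using hb
  · have : x ∉ H := fun hx =>
      hb (hH a x b b ⟨hab, h₁.symm, Or.inl ⟨h₃.symm, h₂⟩⟩ ha hx hb)
    simpa [Holds] using this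
  · simpa [Holds] using ha
  · have : x ∈ H := hH a a b x ⟨hab, h₁, Or.inr ⟨h₃.symm, h₂⟩⟩ ha ha hb
    simpa [Holds] using this

/-- An edge that is cut has its ends in the closed neighbourhoods of `a` and of `b`. -/
theorem nbhd_of_models {H : Finset V} (hab : G.Adj a b)
    (hH : Models (Clause G a b) H) {x y : V} (hx : x ∈ H) (hy : y ∉ H) (hxy : G.Adj x y) :
    (x ≠ a → G.Adj a x) ∧ (y ≠ b → G.Adj b y) := by
  have main : Clash G a x b y → False := by
    intro hc
    have h : Conflict G a b (x, true) (y, false) :=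
      ⟨a, x, b, y, hc, Or.inr (Or.inr forced_fst), Or.inl rfl, Or.inr (Or.inr forced_snd),
        Or.inr (Or.inl rfl)⟩
    have := hH _ _ h.clause (by simpa [Holds] using hx)
    simp [Holds, hy] at this
  constructor
  · intro hne
    by_contra h
    exact main ⟨hab, hxy, Or.inl ⟨hne.symm, h⟩⟩
  · intro hne
    by_contra h
    exact main ⟨hab, hxy, Or.inr ⟨hne.symm, h⟩⟩

/-- The clauses with two literals imply the conditions on four vertices: the ends of cut edges are
common neighbours of `a` and `b`, and then `a` or `b` can replace their other ends, or they are
decided by the edge `ab`. -/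
theorem models_clause_iff [Fintype V] [DecidableEq V] (hG : G.Connected) (hab : G.Adj a b)
    {H : Finset V} : H ∈ edgeHalfspaces G a b ↔ Models (Clause G a b) H := by
  rw [mem_edgeHalfspaces, mem_halfspaces, isHalfspace_iff_clash hG]
  simp only [Finset.mem_coe]
  constructor
  · rintro ⟨hH, ha, hb⟩ l m hlm hl
    have hF : ∀ r, Forced G a b r → Holds H r := fun r => holds_of_forced hab ha hb hH
    rcases hlm with h | h | ⟨x, x', y, y', hc, h₁, h₂, h₃, h₄⟩
    · exact absurd hl (holds_neg.1 (hF _ h))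
    · exact hF _ h
    · by_contra hm
      have hG : ∀ r, Given G a b l (neg m) r → Holds H r := by
        rintro r (rfl | rfl | h)
        · exact hl
        · exact holds_neg.2 hm
        · exact hF r h
      have h₁ := hG _ h₁
      have h₂ := hG _ h₂
      have h₃ := hG _ h₃
      have h₄ := hG _ h₄
      simp only [Holds, iff_true, Bool.false_eq_true, iff_false] at h₁ h₂ h₃ h₄
      exact h₄ (hH x x' y y' hc h₁ h₂ h₃)
  · intro hH
    have hF : ∀ r, Forced G a b r → Holds H r := by
      intro r h
      by_contra hr
      exact hr (hH (neg r) r (Or.inr (Or.inl h)) (holds_neg.2 hr))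
    have ha : a ∈ H := by simpa [Holds] using hF _ forced_fst
    have hb : b ∉ H := by simpa [Holds] using hF _ forced_snd
    refine ⟨?_, ha, hb⟩
    intro x x' y y' hc hx hx' hy
    by_contra hy'
    obtain ⟨hxa, hyb⟩ := nbhd_of_models hab hH hx hy hc.1
    obtain ⟨hxa', hyb'⟩ := nbhd_of_models hab hH hx' hy' hc.2.1
    -- Two literals that hold are not in conflict.
    have hno : ∀ p q, Holds H p → Holds H q → ¬ Conflict G a b p q := fun p q hp hq h =>
      holds_neg.1 (hH _ _ h.clause hp) hq
    have hxl : Holds H (x, true) := by simpa [Holds] using hx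
    have hxl' : Holds H (x', true) := by simpa [Holds] using hx'
    have hyl : Holds H (y, false) := by simpa [Holds] using hy
    have hyl' : Holds H (y', false) := by simpa [Holds] using hy'
    rcases hc.2.2 with hne | hne
    -- If `z` is not decided, it is a common neighbour of `a` and `b`, and `b` replaces `w`.
    · have hrep : ∀ {z w}, z ∈ H → (z ≠ a → G.Adj a z) → G.Adj z w → w ∉ H →
          ∃ p w', Holds H p ∧ G.Adj z w' ∧ (∀ q, Given G a b p q (z, true)) ∧
            (∀ q, Given G a b p q (w', false)) := by
        intro z w hz hza hzw hw
        by_cases hf : Forced G a b (z, true)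
        · exact ⟨(w, false), w, by simpa [Holds] using hw, hzw, fun q => Or.inr (Or.inr hf),
            fun q => Or.inl rfl⟩
        · have hzb : G.Adj b z := by
            simp only [Forced, not_or, not_and, not_not] at hf
            by_contra hzb
            exact hb (hf.2 (hza hf.1) hzb ▸ hz)
          exact ⟨(z, true), b, by simpa [Holds] using hz, hzb.symm, fun q => Or.inl rfl,
            fun q => Or.inr (Or.inr forced_snd)⟩
      obtain ⟨p, w, hp, hxw, h₁, h₂⟩ := hrep hx hxa hc.1 hy
      obtain ⟨q, w', hq, hxw', h₃, h₄⟩ := hrep hx' hxa' hc.2.1 hy'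
      exact hno p q hp hq ⟨x, x', w, w', ⟨hxw, hxw', Or.inl hne⟩, h₁ q, given_swap.1 (h₃ p), h₂ q,
        given_swap.1 (h₄ p)⟩
    · have hrep : ∀ {z w}, z ∉ H → (z ≠ b → G.Adj b z) → G.Adj w z → w ∈ H →
          ∃ p w', Holds H p ∧ G.Adj w' z ∧ (∀ q, Given G a b p q (z, false)) ∧
            (∀ q, Given G a b p q (w', true)) := by
        intro z w hz hzb hzw hw
        by_cases hf : Forced G a b (z, false)
        · exact ⟨(w, true), w, by simpa [Holds] using hw, hzw, fun q => Or.inr (Or.inr hf),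
            fun q => Or.inl rfl⟩
        · have hza : G.Adj a z := by
            simp only [Forced, not_or, not_and, not_not] at hf
            by_contra hza
            exact hz (hf.2 (hzb hf.1) hza ▸ ha)
          exact ⟨(z, false), a, by simpa [Holds] using hz, hza, fun q => Or.inl rfl,
            fun q => Or.inr (Or.inr forced_fst)⟩
      obtain ⟨p, w, hp, hxw, h₁, h₂⟩ := hrep hy hyb hc.1 hx
      obtain ⟨q, w', hq, hxw', h₃, h₄⟩ := hrep hy' hyb' hc.2.1 hx'
      exact hno p q hp hq ⟨w, w', y, y', ⟨hxw, hxw', Or.inr hne⟩, h₂ q, given_swap.1 (h₄ p), h₁ q,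
        given_swap.1 (h₃ p)⟩

/-! ### Reversing clauses -/

/-- The implication from `p` to the complement of `q` can be reversed, or `w` is comparable with
one of its ends. -/
def Reversible (G : SimpleGraph V) (a b w : V) (p q : V × Bool) : Prop :=
  TransGen (Clause G a b) (neg q) p ∨
    ∃ ω, TransGen (Clause G a b) p (w, ω) ∨ TransGen (Clause G a b) (w, ω) (neg q)

theorem Reversible.symm {w : V} {p q : V × Bool} (h : Reversible G a b w p q) :
    Reversible G a b w q p := by
  rcases h with h | ⟨ω, h | h⟩
  · left
    simpa using skew_clause.transGen h
  · exact Or.inr ⟨!ω, Or.inr (skew_clause.transGen h)⟩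
  · exact Or.inr ⟨!ω, Or.inl (by simpa using skew_clause.transGen h)⟩

theorem Reversible.flip {w : V} {p q : V × Bool} (h : Reversible G b a w (neg p) (neg q)) :
    Reversible G a b w p q := by
  rcases h with h | ⟨ω, h | h⟩
  · left
    simpa using transGen_clause_flip h
  · exact Or.inr ⟨!ω, Or.inl (by simpa using transGen_clause_flip h)⟩
  · exact Or.inr ⟨!ω, Or.inr (by simpa using transGen_clause_flip h)⟩

theorem Conflict.reversible {w : V} {p q : V × Bool} (h : Conflict G a b (neg p) (neg q)) :
    Reversible G a b w p q :=
  Or.inl (.single (by simpa using h.symm.clause))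

theorem Conflict.not_free {p : V × Bool} (h : Conflict G a b p p) : ¬ Free (Clause G a b) p.1 :=
  fun hf => hf.not_transGen_neg (.single h.clause)

theorem Given.not_forced_neg (hab : G.Adj a b) {p q r : V × Bool}
    (hp : Free (Clause G a b) p.1) (hq : Free (Clause G a b) q.1) (h : Given G a b p q r) :
    ¬ Forced G a b (neg r) := by
  rcases h with rfl | rfl | h
  · exact fun h => h.not_free_neg hp
  · exact fun h => h.not_free_neg hq
  · exact h.not_forced_neg hab

theorem free_neg {I : V × Bool → V × Bool → Prop} {p : V × Bool} (h : Free I p.1) :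
    Free I (neg p).1 := h

/-- A conflict from an edge outside the closed neighbourhood of `a` makes its ends equivalent. -/
theorem reversible_of_not_adj (hab : G.Adj a b) {w : V} {p q : V × Bool}
    (hp : Free (Clause G a b) p.1) (hq : Free (Clause G a b) q.1) {x y : V} (hxy : G.Adj x y)
    (hx : Given G a b p q (x, true)) (hy : Given G a b p q (y, false))
    (hxa : x ≠ a) (hadj : ¬ G.Adj a x) : Reversible G a b w p q := by
  have hc : Clash G a x b y := ⟨hab, hxy, Or.inl ⟨hxa.symm, hadj⟩⟩
  have hx₁ : ¬ Forced G a b (x, true) := by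
    rintro (h | h)
    · exact hxa h
    · exact hadj h.1
  have hx₂ : ¬ Forced G a b (x, false) := hx.not_forced_neg hab hp hq
  have hxb : x ≠ b := fun h => hx₂ (Or.inl h)
  have hbx : ¬ G.Adj b x := fun h => hx₂ (Or.inr ⟨h, hadj, hxa⟩)
  have main : ∀ {p q : V × Bool}, Free (Clause G a b) p.1 → (x, true) = p →
      Given G a b p q (y, false) → Reversible G a b w p q := by
    rintro p q hp rfl (h | rfl | h)
    · cases h
    · refine Conflict.reversible ⟨a, y, b, x, ⟨hab, hxy.symm, Or.inr ⟨hxb.symm, hbx⟩⟩,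
        Or.inr (Or.inr forced_fst), Or.inr (Or.inl rfl), Or.inr (Or.inr forced_snd), Or.inl rfl⟩
    · exact (Conflict.not_free ⟨a, x, b, y, hc, Or.inr (Or.inr forced_fst), Or.inl rfl,
        Or.inr (Or.inr forced_snd), Or.inr (Or.inr h)⟩ hp).elim
  rcases hx with hx | hx | hx
  · exact main hp hx hy
  · exact (main hq hx (given_swap.1 hy)).symm
  · exact (hx₁ hx).elim

/-- If a vertex `x'` decided by the edge `ab` is adjacent to `y'` but not to `x`, then `x` implies
`y'`; a neighbour `w` of `b` is implied by `x` or implies `y'`, according to whether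
it is adjacent to `x'`. -/
theorem reversible_of_forced {w : V} (hbw : G.Adj b w) {p q : V × Bool}
    (hw : Free (Clause G a b) w) (hp : Free (Clause G a b) p.1)
    {x x' y' : V} (hbx : G.Adj b x) (hxy' : G.Adj x' y')
    (hne : x ≠ x') (hadj : ¬ G.Adj x x') (hx' : Forced G a b (x', true))
    (hx : (x, true) = p) (hy' : Given G a b p q (y', false)) : Reversible G a b w p q := by
  subst hx
  rcases hy' with h | rfl | h
  · cases h
  · right
    by_cases hwx' : G.Adj x' w
    · refine ⟨true, Or.inl (.single (Conflict.clause (q := (w, false)) ⟨x, x', b, w,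
        ⟨hbx.symm, hwx', Or.inl ⟨hne, hadj⟩⟩, Or.inl rfl, Or.inr (Or.inr hx'),
        Or.inr (Or.inr forced_snd), Or.inr (Or.inl rfl)⟩))⟩
    · have hwne : w ≠ x' := by
        rintro rfl
        exact Forced.not_free hx' hw
      exact ⟨true, Or.inr (.single (Conflict.clause ⟨w, x', b, y',
        ⟨hbw.symm, hxy', Or.inl ⟨hwne, fun h => hwx' h.symm⟩⟩, Or.inl rfl, Or.inr (Or.inr hx'),
        Or.inr (Or.inr forced_snd), Or.inr (Or.inl rfl)⟩))⟩
  · exact (Conflict.not_free ⟨x, x', b, y', ⟨hbx.symm, hxy', Or.inl ⟨hne, hadj⟩⟩, Or.inl rfl,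
      Or.inr (Or.inr hx'), Or.inr (Or.inr forced_snd), Or.inr (Or.inr h)⟩ hp).elim

/-- Two nonadjacent vertices decided by the edge `ab` are not both on cut edges, unless some vertex
is forced. -/
theorem false_of_forced {p q : V × Bool}
    (hp : Free (Clause G a b) p.1) (hq : Free (Clause G a b) q.1)
    {x x' y y' : V} (hxy : G.Adj x y) (hxy' : G.Adj x' y') (hne : x ≠ x') (hadj : ¬ G.Adj x x')
    (hfx : Forced G a b (x, true)) (hfx' : Forced G a b (x', true))
    (hy : Given G a b p q (y, false)) (hy' : Given G a b p q (y', false))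
    (hyb : y ≠ b → G.Adj b y) : False := by
  have hc : ∀ {u u'}, G.Adj x u → G.Adj x' u' → Clash G x x' u u' := fun hu hu' =>
    ⟨hu, hu', Or.inl ⟨hne, hadj⟩⟩
  have gF : ∀ {r s t}, Forced G a b t → Given G a b r s t := fun h => Or.inr (Or.inr h)
  have hfree : ∀ {u}, Given G a b p q (u, false) → ¬ Forced G a b (u, false) →
      Free (Clause G a b) u := by
    rintro u (rfl | rfl | h) h'
    · exact hp
    · exact hq
    · exact (h' h).elim
  by_cases h : Forced G a b (y, false) <;> by_cases h' : Forced G a b (y', false)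
  · exact Conflict.not_free (p := p) ⟨x, x', y, y', hc hxy hxy', gF hfx, gF hfx', gF h, gF h'⟩ hp
  · exact Conflict.not_free (p := (y', false))
      ⟨x, x', y, y', hc hxy hxy', gF hfx, gF hfx', gF h, Or.inl rfl⟩ (hfree hy' h')
  · exact Conflict.not_free (p := (y, false))
      ⟨x, x', y, y', hc hxy hxy', gF hfx, gF hfx', Or.inl rfl, gF h'⟩ (hfree hy h)
  · have hfy := hfree hy h
    have hfy' := hfree hy' h'
    by_cases hx'y : G.Adj x' y
    · exact Conflict.not_free (p := (y, false))
        ⟨x, x', y, y, hc hxy hx'y, gF hfx, gF hfx', Or.inl rfl, Or.inl rfl⟩ hfy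
    · have hyx' : y ≠ x' := by
        rintro rfl
        exact hfx'.not_free hfy
      have hby : G.Adj b y := hyb fun hyb => h (Or.inl hyb)
      -- Now `y` implies `y'`, and one of them is true.
      have h₁ : Clause G a b (y, true) (y', true) := Conflict.clause (q := (y', false))
        ⟨y, x', b, y', ⟨hby.symm, hxy', Or.inl ⟨hyx', fun h => hx'y h.symm⟩⟩, Or.inl rfl, gF hfx',
          gF forced_snd, Or.inr (Or.inl rfl)⟩
      have h₂ : Clause G a b (y', false) (y, true) := Conflict.clause (q := (y, false))
        ⟨x, x', y, y', hc hxy hxy', gF hfx, gF hfx', Or.inr (Or.inl rfl), Or.inl rfl⟩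
      exact hfy'.2 (.tail (.single h₂) h₁)

/-- The ends of the two edges are in the closed neighbourhoods of `a` and of `b`, so the case
distinction is whether `x` and `x'` are decided or common neighbours. -/
theorem reversible_of_nonadj (hab : G.Adj a b) {w : V} (hbw : G.Adj b w)
    (hw : Free (Clause G a b) w) {p q : V × Bool} (hp : Free (Clause G a b) p.1)
    (hq : Free (Clause G a b) q.1) {x x' y y' : V} (hxy : G.Adj x y) (hxy' : G.Adj x' y')
    (hne : x ≠ x') (hadj : ¬ G.Adj x x')
    (hx : Given G a b p q (x, true)) (hx' : Given G a b p q (x', true))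
    (hy : Given G a b p q (y, false)) (hy' : Given G a b p q (y', false))
    (hxa : x ≠ a → G.Adj a x) (hxa' : x' ≠ a → G.Adj a x')
    (hyb : y ≠ b → G.Adj b y) : Reversible G a b w p q := by
  have hcommon : ∀ {u}, Given G a b p q (u, true) → (u ≠ a → G.Adj a u) →
      ¬ Forced G a b (u, true) → ((u, true) = p ∨ (u, true) = q) ∧ G.Adj a u ∧ G.Adj b u := by
    intro u hu hua hf
    have hf' : ¬ Forced G a b (u, false) := hu.not_forced_neg hab hp hq
    have hau := hua fun h => hf (Or.inl h)
    refine ⟨?_, hau, ?_⟩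
    · rcases hu with h | h | h
      · exact Or.inl h
      · exact Or.inr h
      · exact (hf h).elim
    · by_contra hbu
      exact hf (Or.inr ⟨hau, hbu, fun h => hf' (Or.inl h)⟩)
  by_cases hf : Forced G a b (x, true) <;> by_cases hf' : Forced G a b (x', true)
  · exact (false_of_forced hp hq hxy hxy' hne hadj hf hf' hy hy' hyb).elim
  · obtain ⟨h | h, -, hbx⟩ := hcommon hx' hxa' hf'
    · exact reversible_of_forced hbw hw hp hbx hxy hne.symm (fun h => hadj h.symm) hf h hy
    · exact (reversible_of_forced hbw hw hq hbx hxy hne.symm (fun h => hadj h.symm) hf h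
        (given_swap.1 hy)).symm
  · obtain ⟨h | h, -, hbx⟩ := hcommon hx hxa hf
    · exact reversible_of_forced hbw hw hp hbx hxy' hne hadj hf' h hy'
    · exact (reversible_of_forced hbw hw hq hbx hxy' hne hadj hf' h (given_swap.1 hy')).symm
  · obtain ⟨h, hax, -⟩ := hcommon hx hxa hf
    obtain ⟨h', hax', -⟩ := hcommon hx' hxa' hf'
    -- The vertices `x` and `x'` lie on different sides of every halfspace.
    have main : ∀ {p q : V × Bool}, (x, true) = p → (x', true) = q → Reversible G a b w p q := by
      rintro _ _ rfl rfl
      exact Conflict.reversible ⟨a, a, x, x', ⟨hax, hax', Or.inr ⟨hne, hadj⟩⟩,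
        Or.inr (Or.inr forced_fst), Or.inr (Or.inr forced_fst), Or.inl rfl, Or.inr (Or.inl rfl)⟩
    rcases h with h | h <;> rcases h' with h' | h'
    · exact (hne (congrArg Prod.fst (h.trans h'.symm))).elim
    · exact main h h'
    · exact (main h h').symm
    · exact (hne (congrArg Prod.fst (h.trans h'.symm))).elim

/-- Every clause between undecided vertices can be reversed, or an undecided common neighbour `w` of
`a` and `b` is comparable with one of its ends. -/
theorem Conflict.reversible_of_free (hab : G.Adj a b) {w : V} (haw : G.Adj a w) (hbw : G.Adj b w)
    (hw : Free (Clause G a b) w) {p q : V × Bool} (hp : Free (Clause G a b) p.1)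
    (hq : Free (Clause G a b) q.1) (h : Conflict G a b p q) : Reversible G a b w p q := by
  have hflip : ∀ {u}, Free (Clause G a b) u → Free (Clause G b a) u := by
    intro u hu
    exact ⟨fun h => hu.2 (by simpa using transGen_clause_flip h),
      fun h => hu.1 (by simpa using transGen_clause_flip h)⟩
  obtain ⟨x, x', y, y', hc, h₁, h₂, h₃, h₄⟩ := h
  by_cases hx : x ≠ a → G.Adj a x
  swap
  · rw [Classical.not_imp] at hx
    exact reversible_of_not_adj hab hp hq hc.1 h₁ h₃ hx.1 hx.2
  by_cases hx' : x' ≠ a → G.Adj a x'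
  swap
  · rw [Classical.not_imp] at hx'
    exact reversible_of_not_adj hab hp hq hc.2.1 h₂ h₄ hx'.1 hx'.2
  have hp' := hflip (free_neg hp)
  have hq' := hflip (free_neg hq)
  by_cases hy : y ≠ b → G.Adj b y
  swap
  · rw [Classical.not_imp] at hy
    exact (reversible_of_not_adj hab.symm hp' hq' hc.1.symm (given_flip.2 h₃) (given_flip.2 h₁)
      hy.1 hy.2).flip
  by_cases hy' : y' ≠ b → G.Adj b y'
  swap
  · rw [Classical.not_imp] at hy'
    exact (reversible_of_not_adj hab.symm hp' hq' hc.2.1.symm (given_flip.2 h₄) (given_flip.2 h₂)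
      hy'.1 hy'.2).flip
  rcases hc.2.2 with ⟨hne, hadj⟩ | ⟨hne, hadj⟩
  · exact reversible_of_nonadj hab hbw hw hp hq hc.1 hc.2.1 hne hadj h₁ h₂ h₃ h₄ hx hx' hy
  · exact (reversible_of_nonadj hab.symm haw (hflip hw) hp' hq' hc.1.symm hc.2.1.symm hne hadj
      (given_flip.2 h₃) (given_flip.2 h₄) (given_flip.2 h₁) (given_flip.2 h₂) hy hy' hx).flip

/-- An undecided vertex is equivalent to a common neighbour of `a` and `b`, since adjacent vertices
outside the neighbourhoods of `a` and `b` are equivalent. -/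
theorem exists_common_neighbor (hG : G.Connected) (hab : G.Adj a b) {x : V}
    (hx : Free (Clause G a b) x) : ∃ w, G.Adj a w ∧ G.Adj b w ∧
      ∀ ω, ReflTransGen (Clause G a b) (x, ω) (w, ω) ∧
        ReflTransGen (Clause G a b) (w, ω) (x, ω) := by
  obtain ⟨p⟩ := hG.preconnected x a
  induction p with
  | nil => exact ((forced_fst (G := G) (b := b)).not_free hx).elim
  | @cons x y z hxy p ih =>
    have hxa : x ≠ z := fun h => (Forced.not_free (l := (x, true)) (Or.inl h)) hx
    have hxb : x ≠ b := fun h => (Forced.not_free (l := (x, false)) (Or.inl h)) hx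
    by_cases hax : G.Adj z x <;> by_cases hbx : G.Adj b x
    · exact ⟨x, hax, hbx, fun ω => ⟨.refl, .refl⟩⟩
    · exact ((Forced.not_free (l := (x, true)) (Or.inr ⟨hax, hbx, hxb⟩)) hx).elim
    · exact ((Forced.not_free (l := (x, false)) (Or.inr ⟨hbx, hax, hxa⟩)) hx).elim
    · have h₁ : Clause G z b (x, true) (y, true) := Conflict.clause (q := (y, false))
        ⟨z, x, b, y, ⟨hab, hxy, Or.inl ⟨hxa.symm, hax⟩⟩, Or.inr (Or.inr forced_fst), Or.inl rfl,
          Or.inr (Or.inr forced_snd), Or.inr (Or.inl rfl)⟩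
      have h₂ : Clause G z b (y, true) (x, true) := Conflict.clause (q := (x, false))
        ⟨z, y, b, x, ⟨hab, hxy.symm, Or.inr ⟨hxb.symm, hbx⟩⟩, Or.inr (Or.inr forced_fst),
          Or.inl rfl, Or.inr (Or.inr forced_snd), Or.inr (Or.inl rfl)⟩
      have h₁' : ∀ ω, Clause G z b (x, ω) (y, ω) := by
        rintro (_ | _)
        · exact skew_clause h₂
        · exact h₁
      have h₂' : ∀ ω, Clause G z b (y, ω) (x, ω) := by
        rintro (_ | _)
        · exact skew_clause h₁
        · exact h₂
      have hy : Free (Clause G z b) y := by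
        rw [free_iff] at hx ⊢
        exact fun σ h => hx σ (.head (h₁' σ) (h.tail (h₂' _)))
      obtain ⟨w, h, h', heq⟩ := ih hab hy
      exact ⟨w, h, h', fun ω => ⟨.head (h₁' ω) (heq ω).1, (heq ω).2.tail (h₂' ω)⟩⟩

/-- Implications between undecided vertices that are independent of an undecided `x` can be
reversed: `x` may be replaced by a common neighbour of `a` and `b`, which is comparable with an end
of every implication that cannot be reversed. -/
theorem transGen_clause_reverse (hG : G.Connected) (hab : G.Adj a b) {x : V} {l m : V × Bool}
    (hx : Free (Clause G a b) x) (hl : Free (Clause G a b) l.1) (hm : Free (Clause G a b) m.1)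
    (hxl : Indep (Clause G a b) x l.1) (hxm : Indep (Clause G a b) x m.1)
    (h : TransGen (Clause G a b) l m) : TransGen (Clause G a b) m l := by
  obtain ⟨w, haw, hbw, hxw⟩ := exists_common_neighbor hG hab hx
  have hw : Free (Clause G a b) w := by
    rw [free_iff] at hx ⊢
    exact fun σ h => hx σ ((TransGen.trans_right (hxw σ).1 h).trans_left (hxw _).2)
  refine transGen_reverse skew_clause (w := w) ?_ hl hm ?_ ?_ h
  · intro l m hlm hl hm
    rcases hlm with h | h | h
    · exact (h.not_free_neg hl).elim
    · exact (h.not_free hm).elim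
    · simpa [Reversible] using h.reversible_of_free hab haw hbw hw hl (free_neg hm)
  · exact fun σ τ hT => (hxl.symm skew_clause) σ τ (hT.trans_left (hxw τ).2)
  · exact fun σ τ hT => hxm σ τ (TransGen.trans_right (hxw σ).1 hT)

end

/-- The number of vertices that are picked for `x` in the family of the edge `ab`; no vertex is
picked if `ab` is not an edge. -/
noncomputable def leaderCount {n : ℕ} (G : SimpleGraph (Fin n)) (a b x : Fin n) : ℕ :=
  {y | G.Adj a b ∧ IsLeader (Clause G a b) x y}.ncard

theorem maxEdgeVCDim_eq_sup_leaderCount {n : ℕ} {G : SimpleGraph (Fin n)} (hG : G.Connected) :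
    maxEdgeVCDim G = Finset.univ.sup fun a => Finset.univ.sup fun b => Finset.univ.sup fun x =>
      leaderCount G a b x := by
  classical
  have hedge : ∀ a b, G.Adj a b → (edgeHalfspaces G a b).vcDim =
      Finset.univ.sup fun x => leaderCount G a b x := by
    intro a b hab
    rw [vcDim_eq_sup_leaders skew_clause (fun H => models_clause_iff hG hab)
      fun x l m => transGen_clause_reverse hG hab]
    refine Finset.sup_congr rfl fun x _ => ?_
    rw [leaderCount, ← Set.ncard_coe_finset]
    simp [hab]
  apply le_antisymm
  · refine Finset.sup_le fun e he => ?_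
    rw [hedge _ _ (Finset.mem_filter.1 he).2]
    exact (Finset.le_sup (f := fun b => Finset.univ.sup fun x => leaderCount G e.1 b x)
      (Finset.mem_univ e.2)).trans (Finset.le_sup
        (f := fun a => Finset.univ.sup fun b => Finset.univ.sup fun x => leaderCount G a b x)
        (Finset.mem_univ e.1))
  · refine Finset.sup_le fun a _ => Finset.sup_le fun b _ => ?_
    by_cases hab : G.Adj a b
    · rw [← hedge a b hab]
      exact vcDim_le_maxEdgeVCDim hab
    · simp [leaderCount, hab]

end Monophonic

/-! ### Polynomial-time state transformations -/

namespace RAM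

/-- The state `s` after the assignment `x := v`. -/
def State.set (s : State) (x v : ℕ) : State := { s with var := Function.update s.var x v }

@[simp] theorem State.arr_set (s : State) (x v : ℕ) : (s.set x v).arr = s.arr := rfl

theorem State.var_set (s : State) (x v y : ℕ) :
    (s.set x v).var y = if y = x then v else s.var y := by
  simp [State.set, Function.update_apply]

@[simp] theorem State.var_set_self (s : State) (x v : ℕ) : (s.set x v).var x = v := by
  simp [State.var_set]

theorem State.var_set_of_ne (s : State) {x y : ℕ} (v : ℕ) (h : y ≠ x) :
    (s.set x v).var y = s.var y := by
  simp [State.var_set, h]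

/-- Two states have the same arrays and agree on the variables below `K`. -/
def Agree (K : ℕ) (s s' : State) : Prop := s.arr = s'.arr ∧ ∀ x < K, s.var x = s'.var x

theorem Agree.refl (K : ℕ) (s : State) : Agree K s s := ⟨rfl, fun _ _ => rfl⟩

theorem Agree.symm {K : ℕ} {s s' : State} (h : Agree K s s') : Agree K s' s :=
  ⟨h.1.symm, fun x hx => (h.2 x hx).symm⟩

theorem Agree.trans {K : ℕ} {s s' s'' : State} (h : Agree K s s') (h' : Agree K s' s'') :
    Agree K s s'' :=
  ⟨h.1.trans h'.1, fun x hx => (h.2 x hx).trans (h'.2 x hx)⟩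

theorem Agree.mono {K K' : ℕ} {s s' : State} (h : Agree K' s s') (hK : K ≤ K') : Agree K s s' :=
  ⟨h.1, fun x hx => h.2 x (hx.trans_le hK)⟩

theorem Agree.set {K : ℕ} {s s' : State} (h : Agree K s s') (x v : ℕ) :
    Agree K (s.set x v) (s'.set x v) :=
  ⟨h.1, fun y hy => by rw [State.var_set, State.var_set, h.2 y hy]⟩

theorem Agree.set_right {K : ℕ} {s s' : State} (h : Agree K s s') {x : ℕ} (v : ℕ) (hx : K ≤ x) :
    Agree K s (s'.set x v) :=
  ⟨h.1, fun y hy => by rw [State.var_set_of_ne _ _ (by omega), h.2 y hy]⟩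

/-- Binding the variable `K` turns agreement below `K` into agreement below `K + 1`. -/
theorem Agree.bind {K : ℕ} {s s' : State} (h : Agree K s s') (v : ℕ) :
    Agree (K + 1) (s.set K v) (s'.set K v) :=
  ⟨h.1, fun y hy => by
    rw [State.var_set, State.var_set]
    split_ifs with hyK
    · rfl
    · exact h.2 y (by omega)⟩

/-- Some program performs the state transformation `φ`, up to the contents of the variables from
`K` on, which it may use as scratch space. The number of steps is polynomial in a bound on the
variables `0` and `1`, which are preserved and serve as the bounds of all loops. -/
structure Exec (K : ℕ) (φ : State → State) : Prop where
  two_le : 2 ≤ K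
  congr : ∀ {s s'}, Agree K s s' → Agree K (φ s) (φ s')
  var_zero : ∀ s, (φ s).var 0 = s.var 0
  var_one : ∀ s, (φ s).var 1 = s.var 1
  runs : ∃ (c : Program) (p : Polynomial ℕ), ∀ (N : ℕ) (s : State), s.var 0 ≤ N → s.var 1 ≤ N →
    ∃ s' t, Runs c s s' t ∧ t ≤ p.eval N ∧ Agree K s' (φ s)

/-- More scratch space may be used, and the result may change in the scratch variables. -/
theorem Exec.weaken {K K' : ℕ} {φ ψ : State → State} (h : Exec K' φ) (hK : 2 ≤ K) (hK' : K ≤ K')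
    (hψ : ∀ {s s'}, Agree K s s' → Agree K (ψ s) (ψ s')) (hφψ : ∀ s, Agree K (φ s) (ψ s)) :
    Exec K ψ where
  two_le := hK
  congr := hψ
  var_zero s := by rw [← (hφψ s).2 0 (by omega), h.var_zero]
  var_one s := by rw [← (hφψ s).2 1 (by omega), h.var_one]
  runs := by
    obtain ⟨c, p, hc⟩ := h.runs
    refine ⟨c, p, fun N s h₀ h₁ => ?_⟩
    obtain ⟨s', t, hr, ht, ha⟩ := hc N s h₀ h₁
    exact ⟨s', t, hr, ht, (ha.mono hK').trans (hφψ s)⟩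

theorem Exec.seq {K : ℕ} {φ ψ : State → State} (h : Exec K φ) (h' : Exec K ψ) :
    Exec K fun s => ψ (φ s) where
  two_le := h.two_le
  congr ha := h'.congr (h.congr ha)
  var_zero s := by rw [h'.var_zero, h.var_zero]
  var_one s := by rw [h'.var_one, h.var_one]
  runs := by
    obtain ⟨c, p, hc⟩ := h.runs
    obtain ⟨c', p', hc'⟩ := h'.runs
    refine ⟨.seq c c', p + p' + 1, fun N s h₀ h₁ => ?_⟩
    obtain ⟨s₁, t₁, hr₁, ht₁, ha₁⟩ := hc N s h₀ h₁
    have hK := h.two_le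
    obtain ⟨s₂, t₂, hr₂, ht₂, ha₂⟩ := hc' N s₁
      (by rwa [ha₁.2 0 (by omega), h.var_zero]) (by rwa [ha₁.2 1 (by omega), h.var_one])
    refine ⟨s₂, _, hr₁.seq hr₂, ?_, ha₂.trans (h'.congr ha₁)⟩
    simp only [Polynomial.eval_add, Polynomial.eval_one]
    omega

theorem Exec.assign {K x : ℕ} (hK : 2 ≤ K) (hx : 2 ≤ x) (e : Expr)
    (he : ∀ {s s'}, Agree K s s' → e.eval s = e.eval s') : Exec K fun s => s.set x (e.eval s) where
  two_le := hK
  congr ha := by rw [he ha]; exact ha.set _ _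
  var_zero s := s.var_set_of_ne _ (by omega)
  var_one s := s.var_set_of_ne _ (by omega)
  runs := ⟨.assign x e, Polynomial.C (e.cost + 1), fun N s _ _ =>
    ⟨_, _, .assign x e s, by simp, Agree.refl _ _⟩⟩

/-- The state `s` after the assignment `A[i, j] := v`. -/
def State.store (s : State) (A i j v : ℕ) : State :=
  { s with arr := Function.update s.arr A (Function.update (s.arr A) i
      (Function.update (s.arr A i) j v)) }

theorem State.arr_store_of_ne (s : State) {A A' : ℕ} (i j v : ℕ) (h : A' ≠ A) :
    (s.store A i j v).arr A' = s.arr A' := by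
  simp [State.store, h]

theorem State.arr_store_self (s : State) (A i j v i' j' : ℕ) :
    (s.store A i j v).arr A i' j' = if i' = i ∧ j' = j then v else s.arr A i' j' := by
  simp only [State.store, Function.update_self, Function.update_apply]
  by_cases hi : i' = i
  · subst hi
    by_cases hj : j' = j <;> simp [hj]
  · simp [hi]

theorem Exec.store {K A x y z : ℕ} (hK : 2 ≤ K) (hx : x < K) (hy : y < K) (hz : z < K) :
    Exec K fun s => s.store A (s.var x) (s.var y) (s.var z) where
  two_le := hK
  congr ha := ⟨by simp only [State.store, ha.1, ha.2 x hx, ha.2 y hy, ha.2 z hz], ha.2⟩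
  var_zero _ := rfl
  var_one _ := rfl
  runs := ⟨.store A (.var x) (.var y) (.var z), 4, fun N s _ _ =>
    ⟨_, _, .store A _ _ _ s, by simp [Expr.cost], Agree.refl _ _⟩⟩

/-- The first `m` rounds of a loop with body `φ` and loop variable `x`. -/
def iter (φ : State → State) (x : ℕ) : ℕ → State → State
  | 0, s => s
  | m + 1, s => φ ((iter φ x m s).set x m)

/-- The loop with body `φ` in which the variable `x` runs from `0` to the value of the variable
`B`, exclusively. -/
def forLoop (φ : State → State) (x B : ℕ) (s : State) : State :=
  (iter φ x (s.var B) s).set x (s.var B)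

theorem var_iter {φ : State → State} {x y : ℕ} (hφ : ∀ s, (φ s).var y = s.var y) (hy : y ≠ x)
    (m : ℕ) (s : State) : (iter φ x m s).var y = s.var y := by
  induction m with
  | zero => rfl
  | succ m ih => rw [iter, hφ, State.var_set_of_ne _ _ hy, ih]

theorem var_forLoop {φ : State → State} {x y : ℕ} (hφ : ∀ s, (φ s).var y = s.var y) (hy : y ≠ x)
    (B : ℕ) (s : State) : (forLoop φ x B s).var y = s.var y := by
  rw [forLoop, State.var_set_of_ne _ _ hy, var_iter hφ hy]

theorem arr_iter {φ : State → State} {A : ℕ} (hφ : ∀ s, (φ s).arr A = s.arr A)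
    (x m : ℕ) (s : State) : (iter φ x m s).arr A = s.arr A := by
  induction m with
  | zero => rfl
  | succ m ih => rw [iter, hφ, State.arr_set, ih]

theorem arr_forLoop {φ : State → State} {A : ℕ} (hφ : ∀ s, (φ s).arr A = s.arr A)
    (x B : ℕ) (s : State) : (forLoop φ x B s).arr A = s.arr A := by
  rw [forLoop, State.arr_set, arr_iter hφ]

theorem Exec.iter_congr {K : ℕ} {φ : State → State} (h : Exec K φ) (x m : ℕ) {s s' : State}
    (ha : Agree K s s') : Agree K (iter φ x m s) (iter φ x m s') := by
  induction m with
  | zero => exact ha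
  | succ m ih => exact h.congr (ih.set _ _)

theorem Exec.forLoop {K x B : ℕ} {φ : State → State} (h : Exec K φ) (hx : 2 ≤ x) (hxK : x < K)
    (hB : B < 2) (hφ : ∀ s, (φ s).var x = s.var x) : Exec K (forLoop φ x B) where
  two_le := h.two_le
  congr := fun {s s'} ha => by
    have := h.two_le
    rw [RAM.forLoop, RAM.forLoop, ha.2 B (by omega)]
    exact (h.iter_congr x _ ha).set _ _
  var_zero s := var_forLoop h.var_zero (by omega) _ _
  var_one s := var_forLoop h.var_one (by omega) _ _
  runs := by
    have hK := h.two_le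
    obtain ⟨c, p, hc⟩ := h.runs
    refine ⟨.seq (.assign x (.const 0)) (.while (.lt (.var x) (.var B))
      (.seq c (.assign x (.add (.var x) (.const 1))))), Polynomial.X * (p + 9) + 7, ?_⟩
    intro N s h₀ h₁
    have hvar : ∀ y < 2, ∀ m, (iter φ x m s).var y = s.var y := by
      intro y hy m
      refine var_iter (fun s => ?_) (by omega) m s
      interval_cases y
      · exact h.var_zero s
      · exact h.var_one s
    have hBN : s.var B ≤ N := by
      interval_cases B
      · exact h₀
      · exact h₁
    -- Induction on the number `r` of rounds that remain.
    have main : ∀ r i σ, i + r = s.var B → Agree K σ ((iter φ x i s).set x i) →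
        ∃ s' t, Runs (.while (.lt (.var x) (.var B))
          (.seq c (.assign x (.add (.var x) (.const 1))))) σ s' t ∧ t ≤ r * (p.eval N + 9) + 4 ∧
          Agree K s' ((iter φ x (s.var B) s).set x (s.var B)) := by
      intro r
      induction r with
      | zero =>
        intro i σ hi ha
        obtain rfl : i = s.var B := by omega
        refine ⟨σ, _, .while_false ?_, by simp [Expr.cost], ha⟩
        have h₁ := ha.2 x hxK
        have h₂ := ha.2 B (by omega)
        rw [State.var_set_self] at h₁
        rw [State.var_set_of_ne _ _ (by omega), hvar B hB] at h₂
        simp [Expr.eval, h₁, h₂]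
      | succ r ih =>
        intro i σ hi ha
        have hσ : ∀ y < 2, σ.var y = s.var y := fun y hy => by
          rw [ha.2 y (by omega), State.var_set_of_ne _ _ (by omega), hvar y hy]
        obtain ⟨s₁, t₁, hr₁, ht₁, ha₁⟩ := hc N σ (by rwa [hσ 0 (by omega)])
          (by rwa [hσ 1 (by omega)])
        have ha₂ : Agree K s₁ (iter φ x (i + 1) s) := ha₁.trans (h.congr ha)
        have hx₁ : s₁.var x = i := by
          rw [ha₂.2 x hxK, iter, hφ, State.var_set_self]
        obtain ⟨s₂, t₂, hr₂, ht₂, ha₃⟩ := ih (i + 1) (s₁.set x (i + 1)) (by omega) (ha₂.set _ _)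
        have hassign : Runs (.assign x (.add (.var x) (.const 1))) s₁ (s₁.set x (i + 1)) 4 := by
          have := Runs.assign x (.add (.var x) (.const 1)) s₁
          simpa [Expr.eval, Expr.cost, hx₁, State.set] using this
        refine ⟨s₂, _, .while_true ?_ (hr₁.seq hassign) hr₂, ?_, ha₃⟩
        · have h₁ := ha.2 x hxK
          rw [State.var_set_self] at h₁
          have : i < s.var B := by omega
          simp [Expr.eval, h₁, hσ B hB, this]
        · rw [Nat.succ_mul]
          simp only [Expr.cost]
          omega
    obtain ⟨s', t, hr, ht, ha⟩ := main (s.var B) 0 (s.set x 0) (by omega) (Agree.refl _ _)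
    refine ⟨s', _, (Runs.assign x (.const 0) s).seq hr, ?_, ha⟩
    have : s.var B * (p.eval N + 9) ≤ N * (p.eval N + 9) := Nat.mul_le_mul_right _ hBN
    simp only [Polynomial.eval_add, Polynomial.eval_mul, Polynomial.eval_X, Polynomial.eval_ofNat,
      Expr.cost]
    omega

/-! ### Polynomial-time evaluation of terms and formulas -/

/-- The value `f s` depends only on the arrays and the variables below `K`, and for every `k ≥ K` a
polynomial-time program stores it in the variable `k`, with only larger variables as scratch
space. -/
structure Comp (K : ℕ) (f : State → ℕ) : Prop where
  two_le : 2 ≤ K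
  congr : ∀ {s s'}, Agree K s s' → f s = f s'
  exec : ∀ {k}, K ≤ k → Exec (k + 1) fun s => s.set k (f s)

theorem Comp.of_expr {K : ℕ} (hK : 2 ≤ K) (e : Expr)
    (he : ∀ {s s'}, Agree K s s' → e.eval s = e.eval s') : Comp K e.eval where
  two_le := hK
  congr := he
  exec hk := Exec.assign (by omega) (by omega) e fun ha => he (ha.mono (by omega))

theorem Comp.const {K : ℕ} (hK : 2 ≤ K) (c : ℕ) : Comp K fun _ => c :=
  .of_expr hK (.const c) fun _ => rfl

theorem Comp.var {K x : ℕ} (hK : 2 ≤ K) (hx : x < K) : Comp K fun s => s.var x :=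
  .of_expr hK (.var x) fun ha => ha.2 x hx

/-- Operations of two arguments: the second argument is evaluated next to the first one. -/
theorem Comp.binop {K : ℕ} {f g : State → ℕ} (hf : Comp K f) (hg : Comp K g)
    (op : (ℕ → ℕ → ℕ → ℕ) → ℕ → ℕ → ℕ) (e : ℕ → Expr)
    (he : ∀ k s, (e k).eval s = op s.arr (s.var k) (s.var (k + 1))) :
    Comp K fun s => op s.arr (f s) (g s) where
  two_le := hf.two_le
  congr ha := by rw [ha.1, hf.congr ha, hg.congr ha]
  exec {k} hk := by
    have hK := hf.two_le
    have h₂ : Exec (k + 1) fun s => s.set k (op s.arr (s.var k) (g s)) := by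
      refine ((hg.exec (k := k + 1) (by omega)).seq (Exec.assign (x := k) (by omega) (by omega)
        (e k) fun ha => by
          rw [he, he, ha.1, ha.2 k (by omega), ha.2 (k + 1) (by omega)])).weaken
        (by omega) (by omega) (fun ha => ?_) fun s => ?_
      · rw [ha.1, ha.2 k (by omega), hg.congr (ha.mono (by omega))]
        exact ha.set _ _
      · rw [he, State.arr_set, State.var_set_self, State.var_set_of_ne _ _ (by omega)]
        exact ((Agree.refl _ _).set_right _ le_rfl).symm.set _ _
    refine ((hf.exec hk).seq h₂).weaken (by omega) le_rfl (fun ha => ?_) fun s => ?_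
    · rw [ha.1, hf.congr (ha.mono (by omega)), hg.congr (ha.mono (by omega))]
      exact ha.set _ _
    · have hg' : g (s.set k (f s)) = g s := hg.congr ((Agree.refl _ _).set_right _ hk).symm
      rw [State.arr_set, State.var_set_self, hg']
      refine ⟨rfl, fun y _ => ?_⟩
      rw [State.var_set, State.var_set, State.var_set]
      split_ifs <;> rfl

theorem Comp.add {K : ℕ} {f g : State → ℕ} (hf : Comp K f) (hg : Comp K g) :
    Comp K fun s => f s + g s :=
  hf.binop hg (fun _ u v => u + v) (fun k => .add (.var k) (.var (k + 1))) fun _ _ => rfl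

theorem Comp.sub {K : ℕ} {f g : State → ℕ} (hf : Comp K f) (hg : Comp K g) :
    Comp K fun s => f s - g s :=
  hf.binop hg (fun _ u v => u - v) (fun k => .sub (.var k) (.var (k + 1))) fun _ _ => rfl

theorem Comp.get {K : ℕ} {f g : State → ℕ} (A : ℕ) (hf : Comp K f) (hg : Comp K g) :
    Comp K fun s => s.arr A (f s) (g s) :=
  hf.binop hg (fun M u v => M A u v) (fun k => .get A (.var k) (.var (k + 1))) fun _ _ => rfl

/-- Bounded sums: the loop variable is `K`, whose old value is saved and restored. -/
theorem Comp.sum {K B : ℕ} (hK : 2 ≤ K) (hB : B < 2) {f : State → ℕ} (hf : Comp (K + 1) f) :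
    Comp K fun s => ∑ i ∈ Finset.range (s.var B), f (s.set K i) where
  two_le := hK
  congr ha := by
    rw [ha.2 B (by omega)]
    exact Finset.sum_congr rfl fun i _ => hf.congr (ha.bind i)
  exec {k} hk := by
    -- The variable `k + 1` keeps the old value of `K`, and `k + 2` accumulates the sum.
    have hbody : Exec (k + 3) fun s => s.set (k + 2) (s.var (k + 2) + f s) := by
      refine ((hf.exec (k := k + 3) (by omega)).seq (Exec.assign (x := k + 2) (by omega) (by omega)
        (.add (.var (k + 2)) (.var (k + 3))) fun ha => by
          simp only [Expr.eval, ha.2 (k + 2) (by omega), ha.2 (k + 3) (by omega)])).weaken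
        (by omega) (by omega) (fun ha => ?_) fun s => ?_
      · rw [ha.2 (k + 2) (by omega), hf.congr (ha.mono (by omega))]
        exact ha.set _ _
      · simp only [Expr.eval]
        rw [State.var_set_self, State.var_set_of_ne _ _ (by omega)]
        exact ((Agree.refl _ _).set_right _ le_rfl).symm.set _ _
    have hloop := hbody.forLoop (x := K) (B := B) hK (by omega) hB
      fun s => s.var_set_of_ne _ (by omega)
    have hsave : Exec (k + 3) fun s => s.set (k + 1) (s.var K) :=
      Exec.assign (by omega) (by omega) (.var K) fun ha => ha.2 K (by omega)
    have hinit : Exec (k + 3) fun s => s.set (k + 2) 0 :=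
      Exec.assign (by omega) (by omega) (.const 0) fun _ => rfl
    have hrestore : Exec (k + 3) fun s => s.set K (s.var (k + 1)) :=
      Exec.assign (by omega) (by omega) (.var (k + 1)) fun ha => ha.2 _ (by omega)
    have hresult : Exec (k + 3) fun s => s.set k (s.var (k + 2)) :=
      Exec.assign (by omega) (by omega) (.var (k + 2)) fun ha => ha.2 _ (by omega)
    refine ((((hsave.seq hinit).seq hloop).seq hrestore).seq hresult).weaken (by omega) (by omega)
      (fun ha => ?_) fun s => ?_
    · have hsum : ∀ s s', Agree (k + 1) s s' →
          ∑ i ∈ Finset.range (s.var B), f (s.set K i) =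
            ∑ i ∈ Finset.range (s'.var B), f (s'.set K i) := fun s s' ha => by
        rw [ha.2 B (by omega)]
        exact Finset.sum_congr rfl fun i _ => hf.congr ((ha.mono (by omega)).bind i)
      rw [hsum _ _ ha]
      exact ha.set _ _
    · set σ := (s.set (k + 1) (s.var K)).set (k + 2) 0 with hσ
      have hiter : ∀ m, Agree (k + 2) ((iter (fun s => s.set (k + 2) (s.var (k + 2) + f s)) K m
          σ).set K 0) (σ.set K 0) ∧ (iter (fun s => s.set (k + 2) (s.var (k + 2) + f s)) K m
          σ).var (k + 2) = ∑ i ∈ Finset.range m, f (s.set K i) := by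
        intro m
        induction m with
        | zero => exact ⟨Agree.refl _ _, by simp [iter, hσ]⟩
        | succ m ih =>
          obtain ⟨ih₁, ih₂⟩ := ih
          refine ⟨⟨ih₁.1, fun y hy => ?_⟩, ?_⟩
          · have := ih₁.2 y hy
            rw [State.var_set, State.var_set] at this ⊢
            split_ifs at this ⊢ with hyK
            · rfl
            · rw [iter, State.var_set_of_ne _ _ (by omega), State.var_set_of_ne _ _ hyK, this]
          · rw [iter, State.var_set_self, State.var_set_of_ne _ _ (by omega), ih₂,
              Finset.sum_range_succ]
            congr 1
            refine hf.congr ⟨ih₁.1, fun y hy => ?_⟩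
            have := ih₁.2 y (by omega)
            rw [State.var_set, State.var_set] at this ⊢
            split_ifs at this ⊢ with hyK
            · rfl
            · rw [this, hσ, State.var_set_of_ne _ _ (by omega), State.var_set_of_ne _ _ (by omega)]
      have hσB : σ.var B = s.var B := by
        rw [hσ, State.var_set_of_ne _ _ (by omega), State.var_set_of_ne _ _ (by omega)]
      obtain ⟨h₁, h₂⟩ := hiter (s.var B)
      simp only [RAM.forLoop, hσB]
      refine ⟨h₁.1, fun y hy => ?_⟩
      rcases eq_or_ne y k with rfl | hyk
      · rw [State.var_set_self, State.var_set_self, State.var_set_of_ne _ _ (by omega),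
          State.var_set_of_ne _ _ (by omega), h₂]
      · rw [State.var_set_of_ne _ _ hyk, State.var_set_of_ne _ _ hyk]
        rcases eq_or_ne y K with rfl | hyK
        · have := h₁.2 (k + 1) (by omega)
          rw [State.var_set_of_ne _ _ (by omega), State.var_set_of_ne _ _ (by omega)] at this
          rw [State.var_set_self, State.var_set_of_ne _ _ (by omega), this, hσ,
            State.var_set_of_ne _ _ (by omega), State.var_set_self]
        · have := h₁.2 y (by omega)
          rw [State.var_set_of_ne _ _ hyK, State.var_set_of_ne _ _ hyK] at this
          rw [State.var_set_of_ne _ _ hyK, State.var_set_of_ne _ _ hyK, this, hσ,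
            State.var_set_of_ne _ _ (by omega), State.var_set_of_ne _ _ (by omega)]

open Classical in
/-- The truth value of the formula `P` can be evaluated in polynomial time. -/
def CompP (K : ℕ) (P : State → Prop) : Prop := Comp K fun s => if P s then 1 else 0

theorem CompP.comp {K : ℕ} {P : State → Prop} [∀ s, Decidable (P s)] (hP : CompP K P) :
    Comp K fun s => if P s then 1 else 0 := by
  unfold CompP at hP
  convert hP

theorem CompP.two_le {K : ℕ} {P : State → Prop} (hP : CompP K P) : 2 ≤ K := Comp.two_le hP

theorem Comp.lt {K : ℕ} {f g : State → ℕ} (hf : Comp K f) (hg : Comp K g) :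
    CompP K fun s => f s < g s := by
  unfold CompP
  convert hf.binop hg (fun _ u v => if u < v then 1 else 0)
    (fun k => .lt (.var k) (.var (k + 1))) fun _ _ => rfl

theorem CompP.of_iff {K : ℕ} {P Q : State → Prop} (hP : CompP K P) (h : ∀ s, P s ↔ Q s) :
    CompP K Q := by
  have : P = Q := funext fun s => propext (h s)
  exact this ▸ hP

theorem CompP.not {K : ℕ} {P : State → Prop} (hP : CompP K P) : CompP K fun s => ¬ P s :=
  (Comp.lt hP (Comp.const hP.two_le 1)).of_iff fun s => by
    by_cases h : P s <;> simp [h]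

theorem CompP.and {K : ℕ} {P Q : State → Prop} (hP : CompP K P) (hQ : CompP K Q) :
    CompP K fun s => P s ∧ Q s :=
  (Comp.lt (Comp.const hP.two_le 1) (Comp.add hP hQ)).of_iff fun s => by
    by_cases h : P s <;> by_cases h' : Q s <;> simp [h, h']

theorem CompP.or {K : ℕ} {P Q : State → Prop} (hP : CompP K P) (hQ : CompP K Q) :
    CompP K fun s => P s ∨ Q s :=
  (Comp.lt (Comp.const hP.two_le 0) (Comp.add hP hQ)).of_iff fun s => by
    by_cases h : P s <;> by_cases h' : Q s <;> simp [h, h']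

theorem Comp.eq {K : ℕ} {f g : State → ℕ} (hf : Comp K f) (hg : Comp K g) :
    CompP K fun s => f s = g s :=
  ((hf.lt hg).not.and (hg.lt hf).not).of_iff fun s => by omega

/-- Count the `i` below the variable `0` with `P s i`, if `P` is evaluated with `i` in the variable
`K`; the side condition says that `P` does not depend on that variable otherwise. -/
theorem CompP.count {K : ℕ} (hK : 2 ≤ K) {P : State → ℕ → Prop} [∀ s i, Decidable (P s i)]
    (hP : CompP (K + 1) fun s => P s (s.var K))
    (hbind : ∀ s i j, P (s.set K i) j ↔ P s j) :
    Comp K fun s => ∑ i ∈ Finset.range (s.var 0), if P s i then 1 else 0 := by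
  have := Comp.sum (B := 0) hK (by omega) hP.comp
  simpa only [State.var_set_self, hbind] using this

theorem CompP.exists_lt {K : ℕ} (hK : 2 ≤ K) {P : State → ℕ → Prop}
    (hP : CompP (K + 1) fun s => P s (s.var K))
    (hbind : ∀ s i j, P (s.set K i) j ↔ P s j) :
    CompP K fun s => ∃ i < s.var 0, P s i := by
  classical
  refine ((Comp.const hK 0).lt (CompP.count hK hP hbind)).of_iff fun s => ?_
  rw [Finset.sum_pos_iff]
  simp only [Finset.mem_range]
  refine exists_congr fun i => and_congr_right fun _ => ?_
  by_cases h : P s i <;> simp [h]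

/-! ### Assigning values of terms -/

theorem Comp.assign {K x : ℕ} {f : State → ℕ} (hf : Comp K f) (hx : 2 ≤ x) :
    Exec K fun s => s.set x (f s) := by
  have hK := hf.two_le
  refine ((hf.exec le_rfl).seq (Exec.assign (x := x) (by omega) hx (.var K) fun ha =>
    ha.2 K (by omega))).weaken hK (by omega) (fun ha => ?_) fun s => ?_
  · rw [hf.congr ha]
    exact ha.set _ _
  · simp only [Expr.eval, State.var_set_self]
    exact ((Agree.refl _ _).set_right _ le_rfl).symm.set _ _

/-- The state `s` after all cells `A[i, j]` with `i`, `j` below the variable `1` have been set to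
the values that the term `f` takes when its variables `K` and `K + 1` are `i` and `j`. -/
def tabulate (K A : ℕ) (f : State → ℕ) (s : State) : State :=
  { s with arr := Function.update s.arr A fun i j =>
      if i < s.var 1 ∧ j < s.var 1 then f ((s.set K i).set (K + 1) j) else s.arr A i j }

@[simp] theorem var_tabulate (K A : ℕ) (f : State → ℕ) (s : State) :
    (tabulate K A f s).var = s.var := rfl

theorem arr_tabulate_of_ne (K : ℕ) {A A' : ℕ} (h : A' ≠ A) (f : State → ℕ) (s : State) :
    (tabulate K A f s).arr A' = s.arr A' := by
  simp [tabulate, h]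

theorem arr_tabulate_self (K A : ℕ) (f : State → ℕ) (s : State) (i j : ℕ) :
    (tabulate K A f s).arr A i j =
      if i < s.var 1 ∧ j < s.var 1 then f ((s.set K i).set (K + 1) j) else s.arr A i j := by
  simp [tabulate]

theorem Comp.tabulate {K A : ℕ} {f : State → ℕ} (hK : 2 ≤ K) (hf : Comp (K + 2) f)
    (hA : ∀ {s s' : State}, (∀ A' ≠ A, s.arr A' = s'.arr A') →
      (∀ x < K + 2, s.var x = s'.var x) → f s = f s') : Exec K (tabulate K A f) := by
  set ψ : State → State := fun s => s.store A (s.var K) (s.var (K + 1)) (f s) with hψ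
  have hstore : Exec (K + 2) ψ := by
    refine ((hf.exec le_rfl).seq (Exec.store (A := A) (x := K) (y := K + 1) (z := K + 2) (by omega)
      (by omega) (by omega) (by omega))).weaken (by omega) (by omega) (fun ha => ?_) fun s => ?_
    · refine ⟨?_, ha.2⟩
      simp only [hψ, State.store, ha.1, ha.2 K (by omega), ha.2 (K + 1) (by omega), hf.congr ha]
    · rw [State.var_set_self, State.var_set_of_ne _ _ (by omega),
        State.var_set_of_ne _ _ (by omega)]
      exact ⟨rfl, fun x hx => State.var_set_of_ne _ _ (by omega)⟩
  have hinner := hstore.forLoop (x := K + 1) (B := 1) (by omega) (by omega) (by omega) fun _ => rfl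
  have houter := hinner.forLoop (x := K) (B := 1) (by omega) (by omega) (by omega)
    fun s => var_forLoop (φ := ψ) (fun _ => rfl) (by omega) _ _
  have hvin : ∀ {y}, y ≠ K + 1 → ∀ m s, (iter ψ (K + 1) m s).var y = s.var y :=
    fun hy m s => var_iter (φ := ψ) (fun _ => rfl) hy m s
  have hvout : ∀ {y}, y ≠ K → y ≠ K + 1 → ∀ m s,
      (iter (forLoop ψ (K + 1) 1) K m s).var y = s.var y :=
    fun h h' m s => var_iter (fun s => var_forLoop (φ := ψ) (fun _ => rfl) h' _ s) h m s
  have hain : ∀ {A'}, A' ≠ A → ∀ m s, (iter ψ (K + 1) m s).arr A' = s.arr A' :=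
    fun h m s => arr_iter (fun s => s.arr_store_of_ne _ _ _ h) _ m s
  have haout : ∀ {A'}, A' ≠ A → ∀ m s,
      (iter (forLoop ψ (K + 1) 1) K m s).arr A' = s.arr A' :=
    fun h m s => arr_iter (fun s => arr_forLoop (fun s => s.arr_store_of_ne _ _ _ h) _ _ s) _ m s
  have hrow : ∀ m s i j, (iter ψ (K + 1) m s).arr A i j =
      if i = s.var K ∧ j < m then f (s.set (K + 1) j) else s.arr A i j := by
    intro m s i j
    induction m with
    | zero => simp [iter]
    | succ m ih =>
      rw [iter, hψ]
      simp only
      rw [State.arr_store_self, State.var_set_self, State.var_set_of_ne _ _ (by omega), ← hψ,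
        hvin (by omega), State.arr_set, ih]
      have hfm : f ((iter ψ (K + 1) m s).set (K + 1) m) = f (s.set (K + 1) m) := by
        refine hA (fun A' h => hain h m s) fun x hx => ?_
        rw [State.var_set, State.var_set]
        split_ifs with h
        · rfl
        · exact hvin h m s
      rw [hfm]
      by_cases hi : i = s.var K
      · rcases lt_trichotomy j m with hj | rfl | hj
        · simp [hi, hj, hj.ne, Nat.lt_succ_of_lt hj]
        · simp [hi]
        · simp [hi, hj.ne', hj.not_gt, show ¬ j < m + 1 by omega]
      · simp [hi]
  have hall : ∀ m s i j, (iter (forLoop ψ (K + 1) 1) K m s).arr A i j =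
      if i < m ∧ j < s.var 1 then f ((s.set K i).set (K + 1) j) else s.arr A i j := by
    intro m s i j
    induction m with
    | zero => simp [iter]
    | succ m ih =>
      rw [iter, RAM.forLoop, State.arr_set, hrow, State.var_set_self,
        State.var_set_of_ne _ _ (by omega), hvout (by omega) (by omega), State.arr_set, ih]
      have hfm : f (((iter (RAM.forLoop ψ (K + 1) 1) K m s).set K m).set (K + 1) j) =
          f ((s.set K m).set (K + 1) j) := by
        refine hA (fun A' h => haout h m s) fun x hx => ?_
        rw [State.var_set, State.var_set, State.var_set, State.var_set]
        split_ifs with h h'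
        · rfl
        · rfl
        · exact hvout h' h m s
      rw [hfm]
      by_cases hj : j < s.var 1
      · rcases lt_trichotomy i m with hi | rfl | hi
        · simp [hi, hj, hi.ne, Nat.lt_succ_of_lt hi]
        · simp [hj]
        · simp [hi.ne', hi.not_gt, show ¬ i < m + 1 by omega]
      · simp [hj]
  refine houter.weaken hK (by omega) (fun {s s'} ha => ?_) fun s => ?_
  · refine ⟨?_, ha.2⟩
    have : ∀ i j, f ((s.set K i).set (K + 1) j) = f ((s'.set K i).set (K + 1) j) :=
      fun i j => hf.congr ((ha.bind i).bind j)
    simp only [RAM.tabulate, ha.1, ha.2 1 (by omega), this]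
  · refine ⟨?_, fun x hx => ?_⟩
    · funext A' i j
      rw [RAM.forLoop, State.arr_set]
      by_cases h : A' = A
      · subst h
        rw [hall, arr_tabulate_self]
      · rw [haout h, arr_tabulate_of_ne K h]
    · rw [RAM.forLoop, State.var_set_of_ne _ _ (by omega), hvout (by omega) (by omega),
        var_tabulate]

end RAM

/-! ### The algorithm -/

namespace RAM

open Relation TwoSat Monophonic

/-- The number that encodes a literal: `x` for `(x, true)` and `x + n` for `(x, false)`. -/
def code {n : ℕ} (l : Fin n × Bool) : ℕ := if l.2 then l.1 else l.1 + n

theorem code_lt {n : ℕ} (l : Fin n × Bool) : code l < n + n := by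
  have := l.1.isLt
  unfold code
  split_ifs <;> omega

theorem exists_code_eq {n k : ℕ} (hk : k < n + n) : ∃ l : Fin n × Bool, code l = k := by
  rcases Nat.lt_or_ge k n with h | h
  · exact ⟨(⟨k, h⟩, true), rfl⟩
  · exact ⟨(⟨k - n, by omega⟩, false), by simp only [code, Bool.false_eq_true, if_false]; omega⟩

theorem code_eq_iff {n : ℕ} {l : Fin n × Bool} {x : Fin n} : code l = x ↔ l = (x, true) := by
  obtain ⟨y, _ | _⟩ := l
  · have := x.isLt
    simp only [code, Bool.false_eq_true, if_false, Prod.mk.injEq, and_false, iff_false]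
    omega
  · simp [code, Fin.ext_iff]

theorem code_eq_add_iff {n : ℕ} {l : Fin n × Bool} {x : Fin n} :
    code l = x + n ↔ l = (x, false) := by
  obtain ⟨y, _ | _⟩ := l
  · simp [code, Fin.ext_iff]
  · have := y.isLt
    simp only [code, if_true, Prod.mk.injEq, Bool.true_eq_false, and_false, iff_false]
    omega

theorem exists_lt_iff_fin {n : ℕ} {P : ℕ → Prop} : (∃ i < n, P i) ↔ ∃ i : Fin n, P i :=
  ⟨fun ⟨i, h, hP⟩ => ⟨⟨i, h⟩, hP⟩, fun ⟨i, hP⟩ => ⟨i, i.isLt, hP⟩⟩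

/-! ### Arithmetical forms of the notions -/

/-- `Monophonic.Forced` for a positive literal, in terms of an adjacency matrix `E`. Negative
literals are covered by exchanging `a` and `b`. -/
def NForced (E : ℕ → ℕ → ℕ) (a b x : ℕ) : Prop := x = a ∨ E a x = 1 ∧ ¬ E b x = 1 ∧ ¬ x = b

/-- `Monophonic.Clash` in terms of an adjacency matrix. -/
def NClash (E : ℕ → ℕ → ℕ) (x x' y y' : ℕ) : Prop :=
  E x y = 1 ∧ E x' y' = 1 ∧ (¬ x = x' ∧ ¬ E x x' = 1 ∨ ¬ y = y' ∧ ¬ E y y' = 1)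

/-- `Monophonic.Clause` in terms of an adjacency matrix and the codes of literals. -/
def NClause (E : ℕ → ℕ → ℕ) (n a b l m : ℕ) : Prop :=
  (∃ x < n, l = x + n ∧ NForced E a b x ∨ l = x ∧ NForced E b a x) ∨
  (∃ x < n, m = x ∧ NForced E a b x ∨ m = x + n ∧ NForced E b a x) ∨
  ∃ x < n, ∃ x' < n, ∃ y < n, ∃ y' < n, NClash E x x' y y' ∧
    (l = x ∨ m = x + n ∨ NForced E a b x) ∧ (l = x' ∨ m = x' + n ∨ NForced E a b x') ∧
    (l = y + n ∨ m = y ∨ NForced E b a y) ∧ (l = y' + n ∨ m = y' ∨ NForced E b a y')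

/-- `TwoSat.Indep` in terms of a matrix of implications between codes. -/
def NIndep (T : ℕ → ℕ → ℕ) (n x y : ℕ) : Prop :=
  ¬ T x y = 1 ∧ ¬ T x (y + n) = 1 ∧ ¬ T (x + n) y = 1 ∧ ¬ T (x + n) (y + n) = 1

/-- `TwoSat.Free` in terms of a matrix of implications between codes. -/
def NFree (T : ℕ → ℕ → ℕ) (n x : ℕ) : Prop := ¬ T x (x + n) = 1 ∧ ¬ T (x + n) x = 1

/-- `TwoSat.Near` in terms of a matrix of implications between codes. -/
def NNear (T : ℕ → ℕ → ℕ) (n x y : ℕ) : Prop :=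
  (¬ ∃ z < n, T z (z + n) = 1 ∧ T (z + n) z = 1) ∧ NFree T n x ∧ NFree T n y ∧
    (y = x ∨ NIndep T n x y)

/-- `TwoSat.IsLeader` in terms of a matrix of implications between codes. -/
def NLeader (T : ℕ → ℕ → ℕ) (n x y : ℕ) : Prop :=
  NNear T n x y ∧ ¬ ∃ z < n, z < y ∧ NNear T n x z ∧ ¬ NIndep T n z y

section

variable {n : ℕ} {G : SimpleGraph (Fin n)} {E : ℕ → ℕ → ℕ}

theorem nForced_iff (hE : ∀ i j : Fin n, E i j = 1 ↔ G.Adj i j) {a b x : Fin n} :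
    NForced E a b x ↔ Forced G a b (x, true) := by
  simp [NForced, Forced, hE, Fin.ext_iff]

theorem nForced_swap_iff (hE : ∀ i j : Fin n, E i j = 1 ↔ G.Adj i j) {a b x : Fin n} :
    NForced E b a x ↔ Forced G a b (x, false) := nForced_iff hE

theorem nClause_iff (hE : ∀ i j : Fin n, E i j = 1 ↔ G.Adj i j) {a b : Fin n}
    {l m : Fin n × Bool} : NClause E n a b (code l) (code m) ↔ Clause G a b l m := by
  have hswap : ∀ x, Forced G b a (x, true) ↔ Forced G a b (x, false) := fun _ => Iff.rfl
  have h₁ : (∃ x < n, code l = x + n ∧ NForced E a b x ∨ code l = x ∧ NForced E b a x) ↔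
      Forced G a b (neg l) := by
    rw [exists_lt_iff_fin]
    simp only [nForced_iff hE, hswap, code_eq_iff, code_eq_add_iff]
    obtain ⟨x, _ | _⟩ := l <;> simp
  have h₂ : (∃ x < n, code m = x ∧ NForced E a b x ∨ code m = x + n ∧ NForced E b a x) ↔
      Forced G a b m := by
    rw [exists_lt_iff_fin]
    simp only [nForced_iff hE, hswap, code_eq_iff, code_eq_add_iff]
    obtain ⟨x, _ | _⟩ := m <;> simp
  have hneg : ∀ r : Fin n × Bool, m = neg r ↔ r = neg m := fun r =>
    ⟨fun h => by rw [h, TwoSat.neg_neg], fun h => by rw [h, TwoSat.neg_neg]⟩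
  have ht : ∀ x : Fin n, (code l = x ∨ code m = x + n ∨ NForced E a b x) ↔
      Given G a b l (neg m) (x, true) := by
    intro x
    rw [code_eq_iff, code_eq_add_iff, nForced_iff hE, Given, eq_comm, ← hneg]
    rfl
  have hf : ∀ x : Fin n, (code l = x + n ∨ code m = x ∨ NForced E b a x) ↔
      Given G a b l (neg m) (x, false) := by
    intro x
    rw [code_eq_iff, code_eq_add_iff, nForced_swap_iff hE, Given, eq_comm, ← hneg]
    rfl
  have hclash : ∀ x x' y y' : Fin n, NClash E x x' y y' ↔ Clash G x x' y y' := by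
    intro x x' y y'
    simp [NClash, Clash, hE, Fin.ext_iff]
  unfold NClause Clause Conflict
  rw [h₁, h₂]
  simp only [exists_lt_iff_fin, ht, hf, hclash]

theorem nLeader_iff {T : ℕ → ℕ → ℕ} {I : Fin n × Bool → Fin n × Bool → Prop}
    (hT : ∀ l m, T (code l) (code m) = 1 ↔ TransGen I l m) {x y : Fin n} :
    NLeader T n x y ↔ IsLeader I x y := by
  have htt : ∀ x y : Fin n, T x y = 1 ↔ TransGen I (x, true) (y, true) := fun x y =>
    hT (x, true) (y, true)
  have htf : ∀ x y : Fin n, T x (y + n) = 1 ↔ TransGen I (x, true) (y, false) := fun x y =>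
    hT (x, true) (y, false)
  have hft : ∀ x y : Fin n, T (x + n) y = 1 ↔ TransGen I (x, false) (y, true) := fun x y =>
    hT (x, false) (y, true)
  have hff : ∀ x y : Fin n, T (x + n) (y + n) = 1 ↔ TransGen I (x, false) (y, false) := fun x y =>
    hT (x, false) (y, false)
  have hindep : ∀ x y : Fin n, NIndep T n x y ↔ Indep I x y := by
    intro x y
    simp only [NIndep, Indep, htt, htf, hft, hff, Bool.forall_bool]
    tauto
  have hnear : ∀ x y : Fin n, NNear T n x y ↔ Near I x y := by
    intro x y
    simp only [NNear, NFree, Near, Sat, Free, exists_lt_iff_fin, hindep, htf, hft, not_exists,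
      Fin.ext_iff]
  simp only [NLeader, IsLeader, exists_lt_iff_fin, hnear, hindep, not_exists, not_and, not_not,
    Fin.lt_def]

/-! ### Evaluating the formulas -/

theorem CompP.edge {K A x y : ℕ} (hK : 2 ≤ K) (hx : x < K) (hy : y < K) :
    CompP K fun s => s.arr A (s.var x) (s.var y) = 1 :=
  (Comp.get A (.var hK hx) (.var hK hy)).eq (.const hK 1)

theorem CompP.nForced {K a b x : ℕ} (hK : 2 ≤ K) (ha : a < K) (hb : b < K) (hx : x < K) :
    CompP K fun s => NForced (s.arr 0) (s.var a) (s.var b) (s.var x) :=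
  ((Comp.var hK hx).eq (.var hK ha)).or
    ((CompP.edge hK ha hx).and ((CompP.edge hK hb hx).not.and
      ((Comp.var hK hx).eq (.var hK hb)).not))

theorem CompP.nClash {K x x' y y' : ℕ} (hK : 2 ≤ K) (hx : x < K) (hx' : x' < K) (hy : y < K)
    (hy' : y' < K) :
    CompP K fun s => NClash (s.arr 0) (s.var x) (s.var x') (s.var y) (s.var y') :=
  (CompP.edge hK hx hy).and ((CompP.edge hK hx' hy').and
    ((((Comp.var hK hx).eq (.var hK hx')).not.and (CompP.edge hK hx hx').not).or
      (((Comp.var hK hy).eq (.var hK hy')).not.and (CompP.edge hK hy hy').not)))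

/-- The variables `3` and `4` hold the ends of the edge, and `6` and `7` the literals. -/
theorem CompP.nClause : CompP 8 fun s =>
    NClause (s.arr 0) (s.var 0) (s.var 3) (s.var 4) (s.var 6) (s.var 7) := by
  have pos : ∀ {K l x}, 2 ≤ K → l < K → x < K → CompP K fun s => s.var l = s.var x :=
    fun hK hl hx => (Comp.var hK hl).eq (.var hK hx)
  have ngv : ∀ {K l x}, 2 ≤ K → l < K → x < K → CompP K fun s => s.var l = s.var x + s.var 0 :=
    fun hK hl hx => (Comp.var hK hl).eq ((Comp.var hK hx).add (.var hK (by omega)))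
  refine CompP.or ?_ (CompP.or ?_ ?_)
  · refine CompP.exists_lt (by omega) (((ngv ?_ ?_ ?_).and (CompP.nForced ?_ ?_ ?_ ?_)).or
      ((pos ?_ ?_ ?_).and (CompP.nForced ?_ ?_ ?_ ?_))) fun s i j => by simp [State.var_set]
    all_goals omega
  · refine CompP.exists_lt (by omega) (((pos ?_ ?_ ?_).and (CompP.nForced ?_ ?_ ?_ ?_)).or
      ((ngv ?_ ?_ ?_).and (CompP.nForced ?_ ?_ ?_ ?_))) fun s i j => by simp [State.var_set]
    all_goals omega
  · refine CompP.exists_lt (by omega) ?_ fun s i j => by simp [State.var_set]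
    refine CompP.exists_lt (by omega) ?_ fun s i j => by simp [State.var_set]
    refine CompP.exists_lt (by omega) ?_ fun s i j => by simp [State.var_set]
    refine CompP.exists_lt (by omega) ?_ fun s i j => by simp [State.var_set]
    refine (CompP.nClash ?_ ?_ ?_ ?_ ?_).and
      (((pos ?_ ?_ ?_).or ((ngv ?_ ?_ ?_).or (CompP.nForced ?_ ?_ ?_ ?_))).and
      (((pos ?_ ?_ ?_).or ((ngv ?_ ?_ ?_).or (CompP.nForced ?_ ?_ ?_ ?_))).and
      (((ngv ?_ ?_ ?_).or ((pos ?_ ?_ ?_).or (CompP.nForced ?_ ?_ ?_ ?_))).and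
      ((ngv ?_ ?_ ?_).or ((pos ?_ ?_ ?_).or (CompP.nForced ?_ ?_ ?_ ?_))))))
    all_goals omega

theorem CompP.entry {K : ℕ} {f g : State → ℕ} (hf : Comp K f) (hg : Comp K g) :
    CompP K fun s => s.arr 1 (f s) (g s) = 1 :=
  (Comp.get 1 hf hg).eq (.const hf.two_le 1)

theorem Comp.varAdd {K x : ℕ} (hK : 2 ≤ K) (hx : x < K) : Comp K fun s => s.var x + s.var 0 :=
  (Comp.var hK hx).add (.var hK (by omega))

theorem CompP.nIndep {K x y : ℕ} (hK : 2 ≤ K) (hx : x < K) (hy : y < K) :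
    CompP K fun s => NIndep (s.arr 1) (s.var 0) (s.var x) (s.var y) :=
  (CompP.entry (.var hK hx) (.var hK hy)).not.and
    ((CompP.entry (.var hK hx) (.varAdd hK hy)).not.and
      ((CompP.entry (.varAdd hK hx) (.var hK hy)).not.and
        (CompP.entry (.varAdd hK hx) (.varAdd hK hy)).not))

theorem CompP.nFree {K x : ℕ} (hK : 2 ≤ K) (hx : x < K) :
    CompP K fun s => NFree (s.arr 1) (s.var 0) (s.var x) :=
  (CompP.entry (.var hK hx) (.varAdd hK hx)).not.and
    (CompP.entry (.varAdd hK hx) (.var hK hx)).not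

theorem CompP.nNear {K x y : ℕ} (hK : 2 ≤ K) (hx : x < K) (hy : y < K) :
    CompP K fun s => NNear (s.arr 1) (s.var 0) (s.var x) (s.var y) := by
  refine CompP.and (CompP.not ?_) ((CompP.nFree hK hx).and ((CompP.nFree hK hy).and
    (((Comp.var hK hy).eq (.var hK hx)).or (CompP.nIndep hK hx hy))))
  refine CompP.exists_lt hK (CompP.and (CompP.entry (.var ?_ ?_) (.varAdd ?_ ?_))
    (CompP.entry (.varAdd ?_ ?_) (.var ?_ ?_)))
    fun s i j => by simp [State.var_set, show 0 ≠ K by omega]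
  all_goals omega

theorem CompP.nLeader {K x y : ℕ} (hK : 2 ≤ K) (hx : x < K) (hy : y < K) :
    CompP K fun s => NLeader (s.arr 1) (s.var 0) (s.var x) (s.var y) := by
  refine (CompP.nNear hK hx hy).and (CompP.not (CompP.exists_lt hK ?_ fun s i j => by
    simp [State.var_set, show 0 ≠ K by omega, hx.ne, hy.ne]))
  refine (Comp.lt (.var ?_ ?_) (.var ?_ ?_)).and ((CompP.nNear ?_ ?_ ?_).and
    (CompP.nIndep ?_ ?_ ?_).not)
  all_goals omega

end

/-! ### The program

The variable `0` holds `n`, the variable `1` holds `2 * n`, the variable `2` the maximum found so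
far, the variables `3` and `4` the vertices `a` and `b`, and the variable `5` is a loop variable.
Array `1` holds the implications between literals. -/

open Classical in
/-- Store the clauses of the edge `ab` in array `1`. -/
noncomputable def initClauses : State → State := tabulate 6 1 fun s =>
  if NClause (s.arr 0) (s.var 0) (s.var 3) (s.var 4) (s.var 6) (s.var 7) then 1 else 0

open Classical in
/-- One round of Warshall's algorithm: add to array `1` the implications through the literal in
variable `5`. The new matrix is built in array `2`. -/
noncomputable def warshallStep (s : State) : State :=
  tabulate 6 1 (fun s => s.arr 2 (s.var 6) (s.var 7)) (tabulate 6 2 (fun s =>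
    if s.arr 1 (s.var 6) (s.var 7) = 1 ∨
      s.arr 1 (s.var 6) (s.var 5) = 1 ∧ s.arr 1 (s.var 5) (s.var 7) = 1 then 1 else 0) s)

open Classical in
/-- The number of leaders for the vertex in the variable `5`, if `ab` is an edge. -/
noncomputable def countLeaders (s : State) : ℕ :=
  ∑ y ∈ Finset.range (s.var 0),
    if s.arr 0 (s.var 3) (s.var 4) = 1 ∧ NLeader (s.arr 1) (s.var 0) (s.var 5) y then 1 else 0

/-- Replace the variable `2` by its maximum with the number of leaders, by truncated
subtraction. -/
noncomputable def updateMax (s : State) : State :=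
  s.set 2 (s.var 2 + (countLeaders s - s.var 2))

/-- Process the edge `ab`. -/
noncomputable def edgeStep (s : State) : State :=
  forLoop updateMax 5 0 (forLoop warshallStep 5 1 (initClauses s))

/-- Process all edges. -/
noncomputable def allEdges : State → State := forLoop (forLoop edgeStep 4 0) 3 0

theorem exec_initClauses : Exec 6 initClauses := by
  refine Comp.tabulate (by omega) CompP.nClause fun {s s'} hs hs' => ?_
  rw [hs 0 (by omega), hs' 0 (by omega), hs' 3 (by omega), hs' 4 (by omega), hs' 6 (by omega),
    hs' 7 (by omega)]

theorem exec_warshallStep : Exec 6 warshallStep := by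
  have edge : ∀ {x y}, x < 8 → y < 8 → CompP 8 fun s => s.arr 1 (s.var x) (s.var y) = 1 :=
    fun hx hy => CompP.edge (by omega) hx hy
  have copy : Comp 8 fun s => s.arr 2 (s.var 6) (s.var 7) :=
    Comp.get 2 (.var (by omega) (by omega)) (.var (by omega) (by omega))
  refine Exec.seq (φ := tabulate 6 2 _) (Comp.tabulate (by omega) ((edge ?_ ?_).or
    ((edge ?_ ?_).and (edge ?_ ?_))).comp fun {s s'} hs hs' => ?_)
    (Comp.tabulate (by omega) copy fun {s s'} hs hs' => ?_)
  any_goals omega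
  · rw [hs 1 (by omega), hs' 5 (by omega), hs' 6 (by omega), hs' 7 (by omega)]
  · rw [hs 2 (by omega), hs' 6 (by omega), hs' 7 (by omega)]

theorem comp_countLeaders : Comp 6 countLeaders := by
  classical
  have hleader : CompP 7 fun s => s.arr 0 (s.var 3) (s.var 4) = 1 ∧
      NLeader (s.arr 1) (s.var 0) (s.var 5) (s.var 6) :=
    (CompP.edge (by omega) (by omega) (by omega)).and
      (CompP.nLeader (by omega) (by omega) (by omega))
  exact CompP.count (K := 6) (P := fun s y => s.arr 0 (s.var 3) (s.var 4) = 1 ∧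
    NLeader (s.arr 1) (s.var 0) (s.var 5) y) (by omega) hleader
    fun s i j => by simp [State.var_set]

theorem exec_updateMax : Exec 6 updateMax :=
  have hmax : Comp 6 fun s => s.var 2 := .var (by omega) (by omega)
  (hmax.add (comp_countLeaders.sub hmax)).assign le_rfl

theorem var_warshallStep (s : State) : (warshallStep s).var = s.var := rfl

theorem var_updateMax {y : ℕ} (hy : y ≠ 2) (s : State) : (updateMax s).var y = s.var y :=
  s.var_set_of_ne _ hy

theorem exec_edgeStep : Exec 6 edgeStep :=
  (exec_initClauses.seq (exec_warshallStep.forLoop (by omega) (by omega) (by omega)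
    fun s => by rw [var_warshallStep])).seq (exec_updateMax.forLoop (by omega) (by omega)
      (by omega) (var_updateMax (by omega)))

theorem var_edgeStep {y : ℕ} (hy : y ≠ 2) (hy' : y ≠ 5) (s : State) :
    (edgeStep s).var y = s.var y := by
  rw [edgeStep, var_forLoop (var_updateMax hy) hy',
    var_forLoop (fun s => by rw [var_warshallStep]) hy', initClauses, var_tabulate]

theorem arr_edgeStep (s : State) : (edgeStep s).arr 0 = s.arr 0 := by
  rw [edgeStep, arr_forLoop (φ := updateMax) (fun _ => rfl), arr_forLoop (fun s => ?_), initClauses,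
    arr_tabulate_of_ne _ (by omega)]
  rw [warshallStep, arr_tabulate_of_ne _ (by omega), arr_tabulate_of_ne _ (by omega)]

theorem exec_allEdges : Exec 6 allEdges := by
  refine Exec.forLoop (Exec.forLoop exec_edgeStep ?_ ?_ ?_ fun s => ?_) ?_ ?_ ?_ fun s => ?_
  any_goals omega
  · exact var_edgeStep (by omega) (by omega) s
  · exact var_forLoop (var_edgeStep (by omega) (by omega)) (by omega) _ _

/-! ### Correctness of the algorithm -/

/-- Warshall's algorithm: after all pivots have been used, a relation has become transitive. -/
theorem iff_transGen_of_pivots {α : Type*} {N : ℕ} (code : α → ℕ) (hlt : ∀ z, code z < N)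
    (hsurj : ∀ k < N, ∃ z, code z = k) (R : ℕ → α → α → Prop)
    (hstep : ∀ z l m, R (code z + 1) l m ↔ R (code z) l m ∨ R (code z) l z ∧ R (code z) z m)
    (l m : α) : R N l m ↔ TransGen (R 0) l m := by
  have main : ∀ k ≤ N, (∀ l m, R 0 l m → R k l m) ∧ (∀ l m, R k l m → TransGen (R 0) l m) ∧
      ∀ z, code z < k → ∀ l m, R k l z → R k z m → R k l m := by
    intro k
    induction k with
    | zero => exact fun _ => ⟨fun _ _ h => h, fun _ _ h => .single h, fun z hz => by omega⟩
    | succ k ih =>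
      intro hk
      obtain ⟨h₁, h₂, h₃⟩ := ih (by omega)
      obtain ⟨p, rfl⟩ := hsurj k (by omega)
      refine ⟨fun l m h => (hstep _ _ _).2 (Or.inl (h₁ l m h)), fun l m h => ?_, ?_⟩
      · rcases (hstep _ _ _).1 h with h | ⟨h, h'⟩
        · exact h₂ _ _ h
        · exact (h₂ _ _ h).trans (h₂ _ _ h')
      · intro z hz l m hl hm
        rcases Nat.lt_succ_iff_lt_or_eq.1 hz with hz | hz
        · have := h₃ z hz
          rw [hstep] at hl hm ⊢
          rcases hl with hl | ⟨hl, hl'⟩ <;> rcases hm with hm | ⟨hm, hm'⟩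
          · exact Or.inl (this _ _ hl hm)
          · exact Or.inr ⟨this _ _ hl hm, hm'⟩
          · exact Or.inr ⟨hl, this _ _ hl' hm⟩
          · exact Or.inr ⟨hl, hm'⟩
        · rw [← hz, hstep] at hl hm ⊢
          rcases hl with hl | ⟨hl, hl'⟩ <;> rcases hm with hm | ⟨hm, hm'⟩
          · exact Or.inr ⟨hl, hm⟩
          · exact Or.inr ⟨hl, hm'⟩
          · exact Or.inr ⟨hl, hm⟩
          · exact Or.inr ⟨hl, hm'⟩
  obtain ⟨h₁, h₂, h₃⟩ := main N le_rfl
  refine ⟨h₂ l m, fun h => ?_⟩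
  induction h with
  | single h => exact h₁ _ _ h
  | tail _ h ih => exact h₃ _ (hlt _) _ _ ih (h₁ _ _ h)

theorem arr_warshallStep {s : State} {i j k : ℕ} (hi : i < s.var 1) (hj : j < s.var 1) :
    (warshallStep (s.set 5 k)).arr 1 i j = 1 ↔
      s.arr 1 i j = 1 ∨ s.arr 1 i k = 1 ∧ s.arr 1 k j = 1 := by
  rw [warshallStep, arr_tabulate_self, if_pos (by simp [State.var_set, hi, hj])]
  simp only [State.arr_set, arr_tabulate_self]
  simp [State.var_set, hi, hj, or_iff_not_imp_left]

theorem arr_warshall {n : ℕ} {s : State} (h₁ : s.var 1 = n + n) (l m : Fin n × Bool) :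
    (forLoop warshallStep 5 1 s).arr 1 (code l) (code m) = 1 ↔
      TransGen (fun l m : Fin n × Bool => s.arr 1 (code l) (code m) = 1) l m := by
  rw [forLoop, State.arr_set, h₁]
  refine iff_transGen_of_pivots (α := Fin n × Bool) code code_lt (fun k => exists_code_eq)
    (fun k l m => (iter warshallStep 5 k s).arr 1 (code l) (code m) = 1) (fun z l m => ?_) l m
  have hvar : (iter warshallStep 5 (code z) s).var 1 = n + n := by
    rw [var_iter (fun s => by rw [var_warshallStep]) (by omega), h₁]
  exact arr_warshallStep (hvar ▸ code_lt l) (hvar ▸ code_lt m)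

/-- A loop whose rounds replace the variable `2` by its maximum with `g i`. -/
theorem forLoop_max {n x B : ℕ} {φ : State → State} (Inv : State → Prop)
    (hInv : ∀ s, Inv s → Inv (φ s)) (hset : ∀ s i, Inv s → Inv (s.set x i)) (hx : 2 ≠ x)
    (g : Fin n → ℕ)
    (hφ : ∀ s (i : Fin n), Inv s → s.var x = i → (φ s).var 2 = max (s.var 2) (g i))
    {s : State} (hs : Inv s) (hB : s.var B = n) :
    (forLoop φ x B s).var 2 = max (s.var 2) (Finset.univ.sup g) := by
  have main : ∀ m ≤ n, Inv (iter φ x m s) ∧ (iter φ x m s).var 2 =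
      max (s.var 2) ((Finset.univ.filter fun i : Fin n => i.1 < m).sup g) := by
    intro m
    induction m with
    | zero => exact fun _ => ⟨hs, by simp [iter]⟩
    | succ m ih =>
      intro hm
      obtain ⟨ih₁, ih₂⟩ := ih (by omega)
      have hins : (Finset.univ.filter fun i : Fin n => i.1 < m + 1) =
          insert ⟨m, hm⟩ (Finset.univ.filter fun i : Fin n => i.1 < m) := by
        ext i
        simp only [Finset.mem_filter, Finset.mem_univ, true_and, Finset.mem_insert, Fin.ext_iff]
        omega
      refine ⟨hInv _ (hset _ _ ih₁), ?_⟩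
      rw [iter, hφ _ ⟨m, hm⟩ (hset _ _ ih₁) (State.var_set_self _ _ _),
        State.var_set_of_ne _ _ hx, ih₂, hins, Finset.sup_insert, max_assoc]
      exact congrArg _ (max_comm _ _)
  rw [forLoop, State.var_set_of_ne _ _ hx, hB, (main n le_rfl).2]
  simp

/-- The state holds the adjacency matrix of `G` in array `0`, and the bounds of the loops. -/
structure Stores {n : ℕ} (G : SimpleGraph (Fin n)) (s : State) : Prop where
  var_zero : s.var 0 = n
  var_one : s.var 1 = n + n
  arr_zero : ∀ i j : Fin n, s.arr 0 i j = 1 ↔ G.Adj i j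

theorem Stores.of_eq {n : ℕ} {G : SimpleGraph (Fin n)} {s s' : State} (hs : Stores G s)
    (h₀ : s'.var 0 = s.var 0) (h₁ : s'.var 1 = s.var 1) (ha : s'.arr 0 = s.arr 0) :
    Stores G s' := ⟨h₀.trans hs.var_zero, h₁.trans hs.var_one, fun i j => by
  rw [ha]; exact hs.arr_zero i j⟩

theorem countLeaders_eq {n : ℕ} {G : SimpleGraph (Fin n)} {s : State} (hs : Stores G s)
    {a b x : Fin n} (ha : s.var 3 = a) (hb : s.var 4 = b) (hx : s.var 5 = x)
    (hT : ∀ l m : Fin n × Bool, s.arr 1 (code l) (code m) = 1 ↔ TransGen (Clause G a b) l m) :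
    countLeaders s = leaderCount G a b x := by
  classical
  rw [countLeaders, hs.var_zero, ha, hb, hx, Finset.sum_range, leaderCount,
    Set.ncard_eq_toFinset_card', Set.toFinset_ofPred, Finset.card_filter]
  refine Finset.sum_congr rfl fun y _ => ?_
  simp only [hs.arr_zero, nLeader_iff hT]

theorem edgeStep_max {n : ℕ} {G : SimpleGraph (Fin n)} {s : State} (hs : Stores G s) {a b : Fin n}
    (ha : s.var 3 = a) (hb : s.var 4 = b) :
    (edgeStep s).var 2 = max (s.var 2) (Finset.univ.sup fun x => leaderCount G a b x) := by
  set s₁ := initClauses s with h₁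
  set s₂ := forLoop warshallStep 5 1 s₁ with h₂
  have harr₁ : ∀ l m : Fin n × Bool, s₁.arr 1 (code l) (code m) = 1 ↔ Clause G a b l m := by
    intro l m
    rw [h₁, initClauses, arr_tabulate_self,
      if_pos ⟨hs.var_one ▸ code_lt l, hs.var_one ▸ code_lt m⟩]
    rw [← nClause_iff hs.arr_zero]
    have hite : ∀ (P : Prop) [Decidable P], (if P then 1 else 0) = 1 ↔ P := fun P _ => by simp
    rw [hite]
    simp [State.var_set, ha, hb, hs.var_zero]
  have harr₂ : ∀ l m : Fin n × Bool,
      s₂.arr 1 (code l) (code m) = 1 ↔ TransGen (Clause G a b) l m := by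
    intro l m
    rw [h₂, arr_warshall (s := s₁) hs.var_one]
    simp only [harr₁]
  have hvar₂ : ∀ y ≠ 5, s₂.var y = s.var y := fun y hy => by
    rw [h₂, var_forLoop (fun s => by rw [var_warshallStep]) hy, h₁, initClauses, var_tabulate]
  have harr₀ : s₂.arr 0 = s.arr 0 := by
    rw [h₂, arr_forLoop (fun s => ?_), h₁, initClauses, arr_tabulate_of_ne _ (by omega)]
    rw [warshallStep, arr_tabulate_of_ne _ (by omega), arr_tabulate_of_ne _ (by omega)]
  have hs₂ : Stores G s₂ := hs.of_eq (hvar₂ 0 (by omega)) (hvar₂ 1 (by omega)) harr₀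
  have := forLoop_max (φ := updateMax) (x := 5) (B := 0)
    (fun σ => σ.arr = s₂.arr ∧ ∀ y, y ≠ 2 → y ≠ 5 → σ.var y = s₂.var y)
    (fun σ hσ => ⟨hσ.1, fun y hy hy' => by rw [var_updateMax hy, hσ.2 y hy hy']⟩)
    (fun σ i hσ => ⟨hσ.1, fun y hy hy' => by rw [State.var_set_of_ne _ _ hy', hσ.2 y hy hy']⟩)
    (by omega) (fun x => leaderCount G a b x) (fun σ i hσ hi => by
      rw [updateMax, State.var_set_self, countLeaders_eq (G := G) (a := a) (b := b) (x := i)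
        (hs₂.of_eq (hσ.2 0 (by omega) (by omega)) (hσ.2 1 (by omega) (by omega)) (by rw [hσ.1]))
        (by rw [hσ.2 3 (by omega) (by omega), hvar₂ 3 (by omega), ha])
        (by rw [hσ.2 4 (by omega) (by omega), hvar₂ 4 (by omega), hb]) hi
        (by rw [hσ.1]; exact harr₂)]
      omega)
    (s := s₂) ⟨rfl, fun _ _ _ => rfl⟩ hs₂.var_zero
  rw [edgeStep, ← h₁, ← h₂, this, hvar₂ 2 (by omega)]

theorem allEdges_max {n : ℕ} {G : SimpleGraph (Fin n)} {s : State} (hs : Stores G s) :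
    (allEdges s).var 2 = max (s.var 2) (Finset.univ.sup fun a => Finset.univ.sup fun b =>
      Finset.univ.sup fun x => leaderCount G a b x) := by
  have hset : ∀ {s : State} {x : ℕ}, 2 ≤ x → Stores G s → ∀ i, Stores G (s.set x i) :=
    fun hx hs i => hs.of_eq (State.var_set_of_ne _ _ (by omega))
      (State.var_set_of_ne _ _ (by omega)) rfl
  have hstep : ∀ s, Stores G s → Stores G (edgeStep s) := fun s hs => hs.of_eq
    (var_edgeStep (by omega) (by omega) s) (var_edgeStep (by omega) (by omega) s) (arr_edgeStep s)
  have hinner : ∀ {s : State} {a : Fin n}, Stores G s → s.var 3 = a →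
      (forLoop edgeStep 4 0 s).var 2 = max (s.var 2) (Finset.univ.sup fun b =>
        Finset.univ.sup fun x => leaderCount G a b x) := by
    intro s a hs ha
    refine forLoop_max (fun s => Stores G s ∧ s.var 3 = a) (fun s hs => ⟨hstep s hs.1, ?_⟩)
      (fun s i hs => ⟨hset (by omega) hs.1 i, ?_⟩) (by omega) _
      (fun s b hs hb => edgeStep_max hs.1 hs.2 hb) ⟨hs, ha⟩ hs.var_zero
    · rw [var_edgeStep (by omega) (by omega), hs.2]
    · rw [State.var_set_of_ne _ _ (by omega), hs.2]
  refine forLoop_max (Stores G) (fun s hs => hs.of_eq ?_ ?_ ?_) (fun s i hs => hset (by omega) hs i)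
    (by omega) _ (fun s a hs ha => hinner hs ha) hs hs.var_zero
  · exact var_forLoop (var_edgeStep (by omega) (by omega)) (by omega) _ _
  · exact var_forLoop (var_edgeStep (by omega) (by omega)) (by omega) _ _
  · exact arr_forLoop arr_edgeStep _ _ _

theorem polyTimeComputable_maxEdgeVCDim :
    PolyTimeComputable (fun _ G => G.Connected) fun _ G => maxEdgeVCDim G := by
  obtain ⟨c, p, hc⟩ := exec_allEdges.runs
  -- The running time of the loops is `p` at `2 * n`, the larger of the two loop bounds.
  refine ⟨.seq (.assign 1 (.add (.var 0) (.var 0))) (.seq c (.assign 0 (.var 2))),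
    p.comp (Polynomial.X + Polynomial.X) + 8, fun n G hG => ?_⟩
  set s₀ := (graphInput G).set 1 (n + n) with hs₀
  have hholds : Stores G s₀ := by
    refine ⟨by simp [hs₀, State.var_set, graphInput], by simp [hs₀], fun i j => ?_⟩
    simp [hs₀, graphInput]
  have hinit : Runs (.assign 1 (.add (.var 0) (.var 0))) (graphInput G) s₀ 4 :=
    Runs.assign 1 (.add (.var 0) (.var 0)) (graphInput G)
  obtain ⟨s', t, hr, ht, ha⟩ := hc (n + n) s₀ (by rw [hholds.var_zero]; omega)
    (by rw [hholds.var_one])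
  refine ⟨_, _, hinit.seq (hr.seq (.assign 0 (.var 2) s')), ?_, ?_⟩
  · simp only [Polynomial.eval_add, Polynomial.eval_comp, Polynomial.eval_X,
      Polynomial.eval_ofNat, Expr.cost]
    omega
  · simp only [Function.update_self, Expr.eval]
    rw [ha.2 2 (by omega), allEdges_max hholds, ← maxEdgeVCDim_eq_sup_leaderCount hG]
    simp [hs₀, State.var_set, graphInput]

end RAM

theorem mainTheorem4 :
    (∀ (V : Type*) [Fintype V] [DecidableEq V] (G : SimpleGraph V), G.Connected →
      Monophonic.maxEdgeVCDim G ≤ (Monophonic.halfspaces G).vcDim ∧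
      (Monophonic.halfspaces G).vcDim ≤ Monophonic.maxEdgeVCDim G + 4) ∧
    RAM.PolyTimeComputable (fun _ G => G.Connected) (fun _ G => Monophonic.maxEdgeVCDim G) :=
  ⟨fun _ _ _ G hG => ⟨Monophonic.maxEdgeVCDim_le_vcDim_halfspaces G,
    Monophonic.vcDim_halfspaces_le hG⟩, RAM.polyTimeComputable_maxEdgeVCDim⟩
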